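/- For a real random variable $\xi$ put $\|\xi\|_{\psi_2}=\inf\{s>0:\ \mathbb E\exp((|\xi|/s)^2)\le 2\}$ and $\mathcal L(\xi,t)=\sup_{y\in\mathbb R}\mathbb P(|\xi-y|\le t)$. For real numbers $s,\delta>0$ let $\mathrm{Sparse}(s)=\{x\in\mathbb R^n:\ |\mathrm{supp}(x)|\le s\}$ and $\mathrm{Comp}(s,\delta)=\{x\in S^{n-1}:\ \mathrm{dist}(x,\mathrm{Sparse}(s))\le\delta\}$, where $\mathrm{dist}$ is the Euclidean distance. For $\nu\in(0,1)$, an $l$-tuple $(v_1,\dots,v_l)$ of nonzero vectors in $\mathbb R^n$, $l\ge 1$, is called $\nu$-almost orthogonal if the $n\times l$ matrix $W$ with columns $v_1/\|v_1\|_2,\dots,v_l/\|v_l\|_2$ satisfies $1-\nu\le s_l(W)\le s_1(W)\le 1+\nu$, where $s_1(W)\ge\dots\ge s_l(W)\ge 0$ are the singular values of $W$, i.e. the square roots of the eigenvalues of the $l\times l$ matrix $W^\top W$. Proposition. Let $K>0$ and $p>0$. There exist $\tau>0$ and $c>0$, depending only on $K$ and $p$, such that the following holds. Let $k,n$ be non-negative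 integers with $k\le n/2$, and let $B$ be an $(n-k)\times n$ random matrix whose entries are independent, identically distributed real random variables, each satisfying $$\mathbb E\,\xi=0,\qquad \|\xi\|_{\psi_2}\le K,\qquad \mathcal L(\xi,1)\le 1-p .$$ Then for every integer $l$ with $1\le l\le\tau^3 n$, the probability that there exists a $\left(\tfrac14\right)$-almost orthogonal $l$-tuple $x_1,\dots,x_l\in\mathrm{Comp}(\tau^2 n,\tau^4)$ with $$\|Bx_j\|_2\le\tau\sqrt n\quad\text{for all } j\in\{1,\dots,l\}$$ is less than $\exp(-c\,l\,n)$. -/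

import Mathlib

open MeasureTheory ProbabilityTheory
open scoped ENNReal Matrix

/-- The set of `s`-sparse vectors of `ℝⁿ`: those with at most `s` nonzero coordinates.
The bound `s` may be any real number. -/
def sparseVectors (n : ℕ) (s : ℝ) : Set (EuclideanSpace ℝ (Fin n)) :=
  {x | ((Function.support fun i => x i).ncard : ℝ) ≤ s}

/-- The compressible vectors `Comp(s, δ)`: unit vectors at Euclidean distance at most `δ` from
the set of `s`-sparse vectors. (For `s ≥ 0` that set contains `0`, so the distance is a genuine
infimum.) -/
def compressibleVectors (n : ℕ) (s δ : ℝ) : Set (EuclideanSpace ℝ (Fin n)) :=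
  {x | ‖x‖ = 1 ∧ Metric.infDist x (sparseVectors n s) ≤ δ}

/-- The `n × l` matrix whose `j`-th column is `v j / ‖v j‖₂`. -/
noncomputable def normalizedColumns {n l : ℕ} (v : Fin l → EuclideanSpace ℝ (Fin n)) :
    Matrix (Fin n) (Fin l) ℝ :=
  Matrix.of fun i j => v j i / ‖v j‖

/-- An `l`-tuple (`l ≥ 1`) of nonzero vectors is `ν`-almost orthogonal if the matrix `W` of its
normalized columns satisfies `1 - ν ≤ s_l(W) ≤ s_1(W) ≤ 1 + ν`. Mathlib numbers the singular
values, in decreasing order, from `0`, so that `s_1` and `s_l` have the indices `0` and `l - 1`;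
the inequality `s_l(W) ≤ s_1(W)` always holds. -/
def AlmostOrthogonal {n l : ℕ} (ν : ℝ) (v : Fin l → EuclideanSpace ℝ (Fin n)) : Prop :=
  (∀ j, v j ≠ 0) ∧
    1 - ν ≤ (Matrix.toEuclideanLin (normalizedColumns v)).singularValues (l - 1) ∧
    (Matrix.toEuclideanLin (normalizedColumns v)).singularValues 0 ≤ 1 + ν

/-- The subgaussian norm `inf {s > 0 : E exp((|ξ|/s)²) ≤ 2}`, with values in `[0, ∞]`; it is `∞`
if there is no such `s`. -/
noncomputable def psi2Norm {Ω : Type*} [MeasurableSpace Ω] (P : Measure Ω) (ξ : Ω → ℝ) : ℝ≥0∞ :=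
  ⨅ (s : ℝ) (_ : 0 < s) (_ : ∫⁻ ω, ENNReal.ofReal (Real.exp ((|ξ ω| / s) ^ 2)) ∂P ≤ 2),
    ENNReal.ofReal s

/-- The Lévy concentration function `sup_y P(|ξ - y| ≤ t)` of a real random variable. -/
noncomputable def levyConcentration {Ω : Type*} [MeasurableSpace Ω] (P : Measure Ω) (ξ : Ω → ℝ)
    (t : ℝ) : ℝ≥0∞ :=
  ⨆ y : ℝ, P {ω | |ξ ω - y| ≤ t}

/-- The standing assumption on a random variable `ξ` with parameters `K` and `p`: it has mean zero,
subgaussian norm at most `K`, and Lévy concentration function at `1` at most `1 - p`.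
(The bound on the subgaussian norm makes a measurable `ξ` integrable.) -/
structure EntryCondition {Ω : Type*} [MeasurableSpace Ω] (P : Measure Ω) (K p : ℝ) (ξ : Ω → ℝ) :
    Prop where
  measurable : Measurable ξ
  mean_zero : ∫ ω, ξ ω ∂P = 0
  psi2Norm_le : psi2Norm P ξ ≤ ENNReal.ofReal K
  levyConcentration_le : levyConcentration P ξ 1 ≤ ENNReal.ofReal (1 - p)

/-- `B` is a random `m × n` matrix with independent, identically distributed entries, each of
which satisfies the standing assumption with parameters `K` and `p`. -/
structure IsIIDMatrix {Ω : Type*} [MeasurableSpace Ω] (P : Measure Ω) (K p : ℝ) {m n : ℕ}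
    (B : Ω → Matrix (Fin m) (Fin n) ℝ) : Prop where
  indep : iIndepFun (fun (a : Fin m × Fin n) ω => B ω a.1 a.2) P
  identDistrib : ∀ i j i' j', IdentDistrib (fun ω => B ω i j) (fun ω => B ω i' j') P P
  entry : ∀ i j, EntryCondition P K p fun ω => B ω i j

/-! ### Exponential moments of subgaussian variables -/

/-! The proof is a union bound over a lattice net. Three estimates enter: a small ball bound for a
fixed matrix, an economical net, and a crude Hilbert-Schmidt bound on `B`.

Small ball. For a fixed `n × l` matrix `Y` correlated with a matrix `X` of norm at most `5/4`, the
Laplace transform of `‖BY‖²` (Hilbert-Schmidt norm) is at most `exp(-κ m l)`, where `m = n - k` and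
`κ` depends only on `K` and `p`. The entries of `B` are integrated out one at a time. Each
integration multiplies the bound by a gain factor and lowers the quadratic form by a rank one term
(`lintegral_exp_neg_quadratic_le`). A dual lower bound for the form, tested on multiples of the rows
of `X`, shows that the gains still add up to order `m l` (`sum_good_rows_ge`,
`lintegral_exp_neg_mul_le`).

Net. Each `x_j` is rounded at random to the lattice `(τ/√n) ℤⁿ`. Independent errors of mean zero
make the image of the error under `B` controllable by the Hilbert-Schmidt norm alone, which is of
order `n` outside an event of probability `exp(-n²)`. For compressible `x_j` the rounded vector has
weight `O(τ n)`, where a nonzero coordinate costs `1/τ` and its size costs `τ³` per unit. With this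
weight there are only `exp(O(τ l n))` rounded tuples (`exists_lattice_approx_compressible`,
`sum_exp_neg_latticeCost_le_exp`). Since `κ` does not depend on `τ`, a small `τ` makes the small
ball bound win. -/

theorem Real.exp_le_add_exp_sq (x : ℝ) : Real.exp x ≤ x + Real.exp (x ^ 2) := by
  have h2 := Real.add_one_le_exp (x ^ 2)
  rcases le_total x (-1) with h | h
  · have : Real.exp x ≤ 1 := Real.exp_le_one_iff.2 (by linarith)
    nlinarith
  rcases le_total x 1 with h' | h'
  · have := (abs_le.1 (Real.abs_exp_sub_one_sub_id_le (abs_le.2 ⟨h, h'⟩))).2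
    linarith
  · have : Real.exp x ≤ Real.exp (x ^ 2) := Real.exp_le_exp.2 (by nlinarith)
    linarith

theorem Real.exp_mul_le_one_add_mul {t : ℝ} (h0 : 0 ≤ t) (h1 : t ≤ 1) (y : ℝ) :
    Real.exp (t * y) ≤ 1 - t + t * Real.exp y := by
  have := convexOn_exp.2 (Set.mem_univ 0) (Set.mem_univ y) (sub_nonneg.2 h1) h0 (by ring)
  simpa using this

theorem Real.exp_neg_le_one_sub_half {x : ℝ} (h0 : 0 ≤ x) (h1 : x ≤ 1) :
    Real.exp (-x) ≤ 1 - x / 2 := by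
  have h2 := Real.add_one_le_exp x
  rw [Real.exp_neg, inv_eq_one_div, div_le_iff₀ (Real.exp_pos x)]
  nlinarith

section Scalar

variable {Ω : Type*} [MeasurableSpace Ω] {P : Measure Ω} {ξ : Ω → ℝ} {s : ℝ}

theorem integrable_exp_sq (hm : Measurable ξ)
    (h2 : ∫⁻ ω, ENNReal.ofReal (Real.exp ((ξ ω / s) ^ 2)) ∂P ≤ 2) :
    Integrable (fun ω => Real.exp ((ξ ω / s) ^ 2)) P :=
  ⟨(by fun_prop : Measurable _).aestronglyMeasurable, by
    rw [hasFiniteIntegral_iff_ofReal (ae_of_all _ fun ω => (Real.exp_pos _).le)]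
    exact h2.trans_lt (by simp)⟩

theorem integral_exp_sq_le (hm : Measurable ξ)
    (h2 : ∫⁻ ω, ENNReal.ofReal (Real.exp ((ξ ω / s) ^ 2)) ∂P ≤ 2) :
    ∫ ω, Real.exp ((ξ ω / s) ^ 2) ∂P ≤ 2 := by
  rw [← ofReal_integral_eq_lintegral_ofReal (integrable_exp_sq hm h2)
    (ae_of_all _ fun ω => (Real.exp_pos _).le)] at h2
  rw [show (2 : ℝ≥0∞) = ENNReal.ofReal 2 by simp] at h2
  exact (ENNReal.ofReal_le_ofReal_iff (by norm_num)).1 h2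

theorem integrable_of_exp_sq (hs : 0 < s) (hm : Measurable ξ)
    (h2 : ∫⁻ ω, ENNReal.ofReal (Real.exp ((ξ ω / s) ^ 2)) ∂P ≤ 2) : Integrable ξ P := by
  refine ((integrable_exp_sq hm h2).const_mul s).mono' hm.aestronglyMeasurable
    (ae_of_all _ fun ω => ?_)
  have h := Real.add_one_le_exp ((ξ ω / s) ^ 2)
  have h' : |ξ ω / s| ≤ Real.exp ((ξ ω / s) ^ 2) := by
    have := sq_abs (ξ ω / s)
    nlinarith [sq_nonneg (|ξ ω / s| - 1)]
  rw [abs_div, abs_of_pos hs, div_le_iff₀ hs] at h'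
  rw [Real.norm_eq_abs]
  linarith

/-- For small `s a` the linear term of `e^y ≤ y + e^(y²)` has mean zero, and convexity compares
`e^(a²ξ²)` with `e^((ξ/s)²)`. For large `s a` the inequality `aξ ≤ (s²a² + (ξ/s)²)/2` is enough. -/
theorem lintegral_exp_mul_le [IsProbabilityMeasure P] (hs : 0 < s) (hm : Measurable ξ)
    (h0 : ∫ ω, ξ ω ∂P = 0)
    (h2 : ∫⁻ ω, ENNReal.ofReal (Real.exp ((ξ ω / s) ^ 2)) ∂P ≤ 2) (a : ℝ) :
    ∫⁻ ω, ENNReal.ofReal (Real.exp (a * ξ ω)) ∂P ≤ ENNReal.ofReal (Real.exp (s ^ 2 * a ^ 2)) := by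
  have hI := integrable_exp_sq hm h2
  have hle := integral_exp_sq_le hm h2
  have hξ := integrable_of_exp_sq hs hm h2
  suffices ∃ g : Ω → ℝ, Integrable g P ∧ (∀ ω, Real.exp (a * ξ ω) ≤ g ω) ∧
      ∫ ω, g ω ∂P ≤ Real.exp (s ^ 2 * a ^ 2) by
    obtain ⟨g, hg, h, h'⟩ := this
    calc _ ≤ ∫⁻ ω, ENNReal.ofReal (g ω) ∂P :=
          lintegral_mono fun ω => ENNReal.ofReal_le_ofReal (h ω)
      _ = ENNReal.ofReal (∫ ω, g ω ∂P) := (ofReal_integral_eq_lintegral_ofReal hg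
          (ae_of_all _ fun ω => (Real.exp_pos _).le.trans (h ω))).symm
      _ ≤ _ := ENNReal.ofReal_le_ofReal h'
  have hsa : 0 ≤ s ^ 2 * a ^ 2 := by positivity
  rcases le_total (s ^ 2 * a ^ 2) 1 with h | h
  · refine ⟨fun ω => a * ξ ω + (1 - s ^ 2 * a ^ 2 +
      s ^ 2 * a ^ 2 * Real.exp ((ξ ω / s) ^ 2)), ?_, fun ω => ?_, ?_⟩
    · exact (hξ.const_mul a).add ((integrable_const _).add (hI.const_mul _))
    · have e : (a * ξ ω) ^ 2 = s ^ 2 * a ^ 2 * (ξ ω / s) ^ 2 := by field_simp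
      have := Real.exp_le_add_exp_sq (a * ξ ω)
      rw [e] at this
      linarith [Real.exp_mul_le_one_add_mul hsa h ((ξ ω / s) ^ 2)]
    · have e := integral_add (hξ.const_mul a) ((integrable_const (μ := P) (1 - s ^ 2 * a ^ 2)).add
        (hI.const_mul (s ^ 2 * a ^ 2)))
      simp only [Pi.add_apply] at e
      rw [e, integral_add (integrable_const _) (hI.const_mul _), integral_const_mul,
        integral_const_mul, h0]
      simp only [integral_const, probReal_univ, smul_eq_mul]
      nlinarith [Real.add_one_le_exp (s ^ 2 * a ^ 2)]
  · refine ⟨fun ω => Real.exp (s ^ 2 * a ^ 2 / 2) * (1 / 2 + 1 / 2 * Real.exp ((ξ ω / s) ^ 2)),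
      ?_, fun ω => ?_, ?_⟩
    · exact ((integrable_const _).add (hI.const_mul _)).const_mul _
    · have h1 := Real.exp_mul_le_one_add_mul (t := 1 / 2) (by norm_num) (by norm_num)
        ((ξ ω / s) ^ 2)
      calc Real.exp (a * ξ ω) ≤ Real.exp (s ^ 2 * a ^ 2 / 2 + 1 / 2 * (ξ ω / s) ^ 2) := by
            refine Real.exp_le_exp.2 ?_
            have e : a * ξ ω = (s * a) * (ξ ω / s) := by field_simp
            rw [e]
            nlinarith [sq_nonneg (s * a - ξ ω / s)]
        _ ≤ _ := by
            rw [Real.exp_add]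
            refine mul_le_mul_of_nonneg_left ?_ (Real.exp_pos _).le
            linarith
    · rw [integral_const_mul, integral_add (integrable_const _) (hI.const_mul _),
        integral_const_mul]
      simp only [integral_const, probReal_univ, smul_eq_mul]
      have e : Real.exp (s ^ 2 * a ^ 2) = Real.exp (s ^ 2 * a ^ 2 / 2) *
          Real.exp (s ^ 2 * a ^ 2 / 2) := by rw [← Real.exp_add]; ring_nf
      rw [e]
      gcongr
      linarith [Real.add_one_le_exp (s ^ 2 * a ^ 2 / 2)]

theorem lintegral_exp_neg_sq_le [IsProbabilityMeasure P] (hm : Measurable ξ) {q : ℝ}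
    (hq0 : 0 ≤ q) (hq1 : q ≤ 1) (hq : P {ω | |ξ ω| ≤ 1} ≤ ENNReal.ofReal (1 - q)) {x : ℝ}
    (hx0 : 0 ≤ x) (hx1 : x ≤ 1) :
    ∫⁻ ω, ENNReal.ofReal (Real.exp (-(x * ξ ω ^ 2))) ∂P
      ≤ ENNReal.ofReal (Real.exp (-(q / 2 * x))) := by
  have hS : MeasurableSet {ω | |ξ ω| ≤ 1} := measurableSet_le hm.abs measurable_const
  have he : Real.exp (-x) ≤ 1 := Real.exp_le_one_iff.2 (by linarith)
  calc _ ≤ ∫⁻ ω, (ENNReal.ofReal (Real.exp (-x)) +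
        {ω | |ξ ω| ≤ 1}.indicator (fun _ => ENNReal.ofReal (1 - Real.exp (-x))) ω) ∂P := by
        refine lintegral_mono fun ω => ?_
        by_cases h : |ξ ω| ≤ 1
        · rw [Set.indicator_of_mem (by exact h), ← ENNReal.ofReal_add (Real.exp_pos _).le
            (by linarith)]
          refine ENNReal.ofReal_le_ofReal ?_
          have : Real.exp (-(x * ξ ω ^ 2)) ≤ 1 :=
            Real.exp_le_one_iff.2 (by have := sq_nonneg (ξ ω); nlinarith)
          linarith
        · rw [Set.indicator_of_notMem (by exact h), add_zero]
          refine ENNReal.ofReal_le_ofReal (Real.exp_le_exp.2 ?_)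
          have : 1 ≤ ξ ω ^ 2 := by
            rw [← sq_abs]; push Not at h; nlinarith
          nlinarith
    _ = ENNReal.ofReal (Real.exp (-x)) +
        ENNReal.ofReal (1 - Real.exp (-x)) * P {ω | |ξ ω| ≤ 1} := by
        rw [lintegral_add_left measurable_const, lintegral_indicator_const hS]
        simp
    _ ≤ ENNReal.ofReal (Real.exp (-x)) +
        ENNReal.ofReal (1 - Real.exp (-x)) * ENNReal.ofReal (1 - q) := by gcongr
    _ ≤ _ := by
        rw [← ENNReal.ofReal_mul (by linarith), ← ENNReal.ofReal_add (Real.exp_pos _).le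
          (mul_nonneg (by linarith) (by linarith))]
        refine ENNReal.ofReal_le_ofReal ?_
        have h1 := Real.exp_neg_le_one_sub_half hx0 hx1
        have h2 := Real.add_one_le_exp (-(q / 2 * x))
        nlinarith

/-- Cauchy-Schwarz separates the subgaussian factor from the anti-concentration factor. Doubling `x`
is what forces `x ≤ 1/2`. This is the only information about a single entry that the small ball
estimate needs. -/
theorem lintegral_exp_mul_sub_sq_le [IsProbabilityMeasure P] (hs : 0 < s) (hm : Measurable ξ)
    (h0 : ∫ ω, ξ ω ∂P = 0)
    (h2 : ∫⁻ ω, ENNReal.ofReal (Real.exp ((ξ ω / s) ^ 2)) ∂P ≤ 2)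
    {q : ℝ} (hq0 : 0 ≤ q) (hq1 : q ≤ 1)
    (hq : P {ω | |ξ ω| ≤ 1} ≤ ENNReal.ofReal (1 - q)) (a : ℝ) {x : ℝ} (hx0 : 0 ≤ x)
    (hx1 : x ≤ 1 / 2) :
    ∫⁻ ω, ENNReal.ofReal (Real.exp (a * ξ ω - x * ξ ω ^ 2)) ∂P
      ≤ ENNReal.ofReal (Real.exp (2 * s ^ 2 * a ^ 2 - q / 2 * x)) := by
  have key := ENNReal.lintegral_mul_le_Lp_mul_Lq P (p := 2) (q := 2)
    ⟨by norm_num, by norm_num, by norm_num⟩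
    (f := fun ω => ENNReal.ofReal (Real.exp (a * ξ ω)))
    (g := fun ω => ENNReal.ofReal (Real.exp (-(x * ξ ω ^ 2))))
    (by fun_prop) (by fun_prop)
  have e (y : ℝ) : ENNReal.ofReal (Real.exp y) ^ (2 : ℝ) = ENNReal.ofReal (Real.exp (2 * y)) := by
    rw [ENNReal.ofReal_rpow_of_pos (Real.exp_pos _), ← Real.exp_mul, mul_comm]
  have e' (y : ℝ) : ENNReal.ofReal (Real.exp y) ^ (1 / 2 : ℝ)
      = ENNReal.ofReal (Real.exp (y / 2)) := by
    rw [ENNReal.ofReal_rpow_of_pos (Real.exp_pos _), ← Real.exp_mul]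
    ring_nf
  calc _ = ∫⁻ ω, ((fun ω => ENNReal.ofReal (Real.exp (a * ξ ω))) *
        fun ω => ENNReal.ofReal (Real.exp (-(x * ξ ω ^ 2)))) ω ∂P := by
        refine lintegral_congr fun ω => ?_
        rw [Pi.mul_apply, ← ENNReal.ofReal_mul (Real.exp_pos _).le, ← Real.exp_add,
          sub_eq_add_neg]
    _ ≤ _ := key
    _ ≤ ENNReal.ofReal (Real.exp (s ^ 2 * (2 * a) ^ 2)) ^ (1 / 2 : ℝ) *
        ENNReal.ofReal (Real.exp (-(q / 2 * (2 * x)))) ^ (1 / 2 : ℝ) := by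
        simp only [e]
        gcongr
        · simp only [← mul_assoc]
          exact lintegral_exp_mul_le hs hm h0 h2 (2 * a)
        · simp only [mul_neg, ← mul_assoc 2 x]
          exact lintegral_exp_neg_sq_le hm hq0 hq1 hq (by linarith) (by linarith)
    _ = _ := by
        rw [e', e', ← ENNReal.ofReal_mul (Real.exp_pos _).le, ← Real.exp_add]
        ring_nf

theorem EntryCondition.lintegral_exp_sq_le {K p : ℝ} (hK : 0 < K) (h : EntryCondition P K p ξ) :
    ∫⁻ ω, ENNReal.ofReal (Real.exp ((ξ ω / (2 * K)) ^ 2)) ∂P ≤ 2 := by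
  -- The factor 2 gives strict room, so that an admissible `s` below `2K` can be extracted from the
  -- infimum.
  have h1 : psi2Norm P ξ < ENNReal.ofReal (2 * K) :=
    h.psi2Norm_le.trans_lt ((ENNReal.ofReal_lt_ofReal_iff (by linarith)).2 (by linarith))
  simp only [psi2Norm, iInf_lt_iff] at h1
  obtain ⟨s, hs, h2, h3⟩ := h1
  rw [ENNReal.ofReal_lt_ofReal_iff (by linarith)] at h3
  refine le_trans (lintegral_mono fun ω => ENNReal.ofReal_le_ofReal (Real.exp_le_exp.2 ?_)) h2
  rw [div_pow, div_pow, sq_abs]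
  gcongr

theorem EntryCondition.measure_abs_le_one_le {K p : ℝ} (h : EntryCondition P K p ξ) :
    P {ω | |ξ ω| ≤ 1} ≤ ENNReal.ofReal (1 - min p 1) := by
  have h1 : P {ω | |ξ ω| ≤ 1} ≤ levyConcentration P ξ 1 := by
    have := le_iSup (fun y : ℝ => P {ω | |ξ ω - y| ≤ 1}) 0
    simpa [levyConcentration] using this
  refine (h1.trans h.levyConcentration_le).trans (ENNReal.ofReal_le_ofReal ?_)
  linarith [min_le_left p 1]

end Scalar

/-! ### A small ball estimate for quadratic forms in independent variables -/

section QuadraticForm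

variable {Ω : Type*} [MeasurableSpace Ω] {P : Measure Ω}

theorem ProbabilityTheory.IndepFun.lintegral_comp_pair {α β : Type*} [MeasurableSpace α]
    [MeasurableSpace β] [IsFiniteMeasure P] {X : Ω → α} {Y : Ω → β} (h : IndepFun X Y P)
    (hX : Measurable X) (hY : Measurable Y) {F : α → β → ℝ≥0∞}
    (hF : Measurable (Function.uncurry F)) :
    ∫⁻ ω, F (X ω) (Y ω) ∂P = ∫⁻ ω, ∫⁻ ω', F (X ω) (Y ω') ∂P ∂P := by
  have e := h.map_prod_eq_prod_map_map hX.aemeasurable hY.aemeasurable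
  calc ∫⁻ ω, F (X ω) (Y ω) ∂P
      = ∫⁻ z, Function.uncurry F z ∂(P.map fun ω => (X ω, Y ω)) := by
        rw [lintegral_map hF (hX.prodMk hY)]; rfl
    _ = ∫⁻ x, ∫⁻ y, F x y ∂(P.map Y) ∂(P.map X) := by
        rw [e, lintegral_prod _ hF.aemeasurable]; rfl
    _ = ∫⁻ x, ∫⁻ ω', F x (Y ω') ∂P ∂(P.map X) := by
        refine lintegral_congr fun x => ?_
        exact lintegral_map (hF.comp measurable_prodMk_left) hY
    _ = _ := by
        rw [lintegral_map _ hX]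
        have : Measurable (Function.uncurry fun (x : α) (ω' : Ω) => F x (Y ω')) :=
          hF.comp (measurable_fst.prodMk (hY.comp measurable_snd))
        exact this.lintegral_prod_right

variable {E : Type*} [NormedAddCommGroup E] [InnerProductSpace ℝ E]

/-- The rank one downdate `Q - r Q(w, ·) ⊗ Q(w, ·)` of a bilinear form. -/
noncomputable def rankOneDowndate (Q : E →L[ℝ] E →L[ℝ] ℝ) (r : ℝ) (w : E) : E →L[ℝ] E →L[ℝ] ℝ :=
  Q - r • (Q w).smulRight (Q w)

@[simp]
theorem rankOneDowndate_apply (Q : E →L[ℝ] E →L[ℝ] ℝ) (r : ℝ) (w x y : E) :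
    rankOneDowndate Q r w x y = Q x y - r * (Q w x * Q w y) := by
  simp [rankOneDowndate]

theorem quadratic_add_smul {Q : E →L[ℝ] E →L[ℝ] ℝ} (hs : ∀ x y, Q x y = Q y x) (S w : E)
    (t : ℝ) : Q (S + t • w) (S + t • w) = Q S S + 2 * t * Q w S + t ^ 2 * Q w w := by
  simp only [map_add, map_smul, add_apply, smul_apply, smul_eq_mul, hs S w]
  ring

/-- A quadratic form with Legendre-type lower bound `2⟨u, S⟩ - N u` keeps such a bound after a rank
one downdate, if `N` is increased by a rank one form. -/
theorem le_rankOneDowndate {Q : E →L[ℝ] E →L[ℝ] ℝ} (hs : ∀ x y, Q x y = Q y x) {N : E → ℝ}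
    (hN : ∀ u S, 2 * inner ℝ u S - N u ≤ Q S S) {r : ℝ} (hr : 0 ≤ r) {w : E}
    (hw : r * Q w w ≤ 1 / 2) (u S : E) :
    2 * inner ℝ u S - (N u + 2 * r * inner ℝ w u ^ 2) ≤ rankOneDowndate Q r w S S := by
  -- For invertible forms this is Sherman-Morrison: the inverse gains `r/(1 - r Q(w,w)) w ⊗ w`, at
  -- most `2r w ⊗ w`. The shift of `S` along `w` proves it without inverses.
  have h := hN u (S + (-(r * Q w S)) • w)
  rw [quadratic_add_smul hs, inner_add_right, inner_smul_right, real_inner_comm w u] at h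
  rw [rankOneDowndate_apply]
  have h1 : r * Q w S ^ 2 * (r * Q w w) ≤ r * Q w S ^ 2 * (1 / 2) :=
    mul_le_mul_of_nonneg_left hw (by positivity)
  have h2 : 0 ≤ r * (Q w S - 2 * inner ℝ w u) ^ 2 := by positivity
  nlinarith

variable [MeasurableSpace E] [BorelSpace E] [SecondCountableTopology E] [IsProbabilityMeasure P]

/-- Integrating out `ξ a` in `exp(-Q(S + ξ a • w a))` gives at most `exp(-κ Q(w a, w a) - Q(S) + 4C
Q(w a, S)²)`: a gain, times the same expression for the downdated form. Later gains use a smaller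
form, so they are bounded below through the dual function `N`, which grows only by `8C⟨w a, ·⟩²` per
step. The induction therefore runs over all `Q`, `N` and shifts `S₀`. -/
theorem lintegral_exp_neg_quadratic_le {ι : Type*} [DecidableEq ι] {ξ : ι → Ω → ℝ}
    (hind : iIndepFun ξ P) (hm : ∀ i, Measurable (ξ i)) {C κ lam : ℝ} (hC : 0 ≤ C) (hκ : 0 ≤ κ)
    (hξ : ∀ i a x, 0 ≤ x → x ≤ 1 / 2 →
      ∫⁻ ω, ENNReal.ofReal (Real.exp (a * ξ i ω - x * ξ i ω ^ 2)) ∂P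
        ≤ ENNReal.ofReal (Real.exp (C * a ^ 2 - κ * x)))
    (w u : ι → E) (good : ι → Prop) [DecidablePred good]
    (hg : ∀ i, good i → lam * ‖w i‖ ^ 2 ≤ 1 / 2 ∧ 4 * C * (lam * ‖w i‖ ^ 2) ≤ 1 / 2)
    (t : Finset ι) (Q : E →L[ℝ] E →L[ℝ] ℝ) (N : E → ℝ) (hs : ∀ x y, Q x y = Q y x)
    (hN : ∀ u S, 2 * inner ℝ u S - N u ≤ Q S S) (hN0 : N 0 ≤ 0)
    (hQ : ∀ S, Q S S ≤ lam * ‖S‖ ^ 2) (S₀ : E) :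
    ∫⁻ ω, ENNReal.ofReal (Real.exp (-(Q (S₀ + ∑ i ∈ t, ξ i ω • w i)
        (S₀ + ∑ i ∈ t, ξ i ω • w i)))) ∂P
      ≤ ENNReal.ofReal (Real.exp (-(κ * ∑ i ∈ t with good i, (2 * inner ℝ (u i) (w i) - N (u i)
          - 8 * C * ∑ j ∈ t with good j, inner ℝ (w j) (u i) ^ 2)))) := by
  induction t using Finset.induction_on generalizing Q N S₀ with
  | empty =>
    have := hN 0 S₀
    simp only [inner_zero_left] at this
    simp only [Finset.sum_empty, add_zero, lintegral_const, measure_univ, mul_one,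
      Finset.filter_empty, mul_zero, neg_zero]
    exact ENNReal.ofReal_le_ofReal (Real.exp_le_exp.2 (by linarith))
  | insert a t ha ih =>
    have hTm : Measurable fun ω => ∑ i ∈ t, ξ i ω • w i :=
      Finset.measurable_sum _ fun i _ => (hm i).smul_const _
    have hI : IndepFun (ξ a) (fun ω => ∑ i ∈ t, ξ i ω • w i) P := by
      have h1 := hind.indepFun_finset {a} t (by simpa using ha) hm
      have hp : Measurable fun x : ({a} : Finset ι) → ℝ => x ⟨a, Finset.mem_singleton_self a⟩ :=
        measurable_pi_apply (⟨a, Finset.mem_singleton_self a⟩ : ({a} : Finset ι))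
      have h2 := h1.comp (ψ := fun x : t → ℝ => ∑ i : t, x i • w i) hp
        (Finset.measurable_sum _ fun i _ => (measurable_pi_apply i).smul_const _)
      have e : ((fun x : t → ℝ => ∑ i : t, x i • w i) ∘ fun ω (i : t) => ξ i ω) =
          fun ω => ∑ i ∈ t, ξ i ω • w i := by
        ext ω
        simp only [Function.comp]
        exact Finset.sum_coe_sort t fun i => ξ i ω • w i
      rw [e] at h2
      exact h2
    have hqc : Continuous fun x : E => Q x x := Q.continuous.clm_apply continuous_id
    simp only [Finset.sum_insert ha, Finset.filter_insert]
    have eadd (ω : Ω) : S₀ + (ξ a ω • w a + ∑ i ∈ t, ξ i ω • w i) =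
      S₀ + ∑ i ∈ t, ξ i ω • w i + ξ a ω • w a := by abel
    simp only [eadd]
    -- A good index is integrated out with the others frozen. A bad one, too large for the scalar
    -- estimate, is frozen itself and absorbed into the shift `S₀`.
    by_cases hga : good a
    · simp only [hga, if_true]
      rw [hI.symm.lintegral_comp_pair hTm (hm a) (F := fun T x =>
        ENNReal.ofReal (Real.exp (-(Q (S₀ + T + x • w a) (S₀ + T + x • w a))))) (by
          refine Measurable.ennreal_ofReal (Real.measurable_exp.comp ?_)
          exact (hqc.measurable.comp (by fun_prop)).neg)]
      obtain ⟨hg1, hg2⟩ := hg a hga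
      have hθ0 : 0 ≤ Q (w a) (w a) := by
        have := hN 0 (w a)
        simp only [inner_zero_left] at this
        linarith
      have hθ1 := hQ (w a)
      have step (S : E) : ∫⁻ ω, ENNReal.ofReal (Real.exp (-(Q (S + ξ a ω • w a)
          (S + ξ a ω • w a)))) ∂P ≤ ENNReal.ofReal (Real.exp (-(κ * Q (w a) (w a)))) *
          ENNReal.ofReal (Real.exp (-(rankOneDowndate Q (4 * C) (w a) S S))) := by
        calc _ = ∫⁻ ω, ENNReal.ofReal (Real.exp (-(Q S S))) * ENNReal.ofReal
              (Real.exp ((-(2 * Q (w a) S)) * ξ a ω - Q (w a) (w a) * ξ a ω ^ 2)) ∂P := by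
              refine lintegral_congr fun ω => ?_
              rw [← ENNReal.ofReal_mul (Real.exp_pos _).le, ← Real.exp_add,
                quadratic_add_smul hs]
              ring_nf
          _ = ENNReal.ofReal (Real.exp (-(Q S S))) * ∫⁻ ω, ENNReal.ofReal
              (Real.exp ((-(2 * Q (w a) S)) * ξ a ω - Q (w a) (w a) * ξ a ω ^ 2)) ∂P := by
              have := hm a
              exact lintegral_const_mul _ (by fun_prop)
          _ ≤ ENNReal.ofReal (Real.exp (-(Q S S))) * ENNReal.ofReal
              (Real.exp (C * (-(2 * Q (w a) S)) ^ 2 - κ * Q (w a) (w a))) := by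
              gcongr
              exact hξ a _ _ hθ0 (hθ1.trans hg1)
          _ = _ := by
              rw [← ENNReal.ofReal_mul (Real.exp_pos _).le, ← Real.exp_add,
                ← ENNReal.ofReal_mul (Real.exp_pos _).le, ← Real.exp_add, rankOneDowndate_apply]
              ring_nf
      have ih' := ih (rankOneDowndate Q (4 * C) (w a))
        (fun u => N u + 2 * (4 * C) * inner ℝ (w a) u ^ 2)
        (fun x y => by simp only [rankOneDowndate_apply, hs x y]; ring)
        (le_rankOneDowndate hs hN (by positivity)
          (le_trans (mul_le_mul_of_nonneg_left hθ1 (by positivity)) hg2))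
        (by simpa using hN0)
        (fun S => by
          rw [rankOneDowndate_apply]
          have : 0 ≤ 4 * C * (Q (w a) S * Q (w a) S) :=
            mul_nonneg (by positivity) (mul_self_nonneg _)
          linarith [hQ S]) S₀
      calc _ ≤ ∫⁻ ω, ENNReal.ofReal (Real.exp (-(κ * Q (w a) (w a)))) *
          ENNReal.ofReal (Real.exp (-(rankOneDowndate Q (4 * C) (w a)
            (S₀ + ∑ i ∈ t, ξ i ω • w i) (S₀ + ∑ i ∈ t, ξ i ω • w i)))) ∂P :=
            lintegral_mono fun ω => step _
        _ = ENNReal.ofReal (Real.exp (-(κ * Q (w a) (w a)))) *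
          ∫⁻ ω, ENNReal.ofReal (Real.exp (-(rankOneDowndate Q (4 * C) (w a)
            (S₀ + ∑ i ∈ t, ξ i ω • w i) (S₀ + ∑ i ∈ t, ξ i ω • w i)))) ∂P := by
            refine lintegral_const_mul _ ?_
            have hqc' : Continuous fun x : E => rankOneDowndate Q (4 * C) (w a) x x :=
              (rankOneDowndate Q (4 * C) (w a)).continuous.clm_apply continuous_id
            refine Measurable.ennreal_ofReal (Real.measurable_exp.comp ?_)
            exact (hqc'.measurable.comp (by fun_prop)).neg
        _ ≤ _ := mul_le_mul_right ih' _
        _ ≤ _ := by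
            rw [← ENNReal.ofReal_mul (Real.exp_pos _).le, ← Real.exp_add]
            refine ENNReal.ofReal_le_ofReal (Real.exp_le_exp.2 ?_)
            have hna : a ∉ t.filter good := fun h => ha (Finset.mem_filter.1 h).1
            rw [Finset.sum_insert hna, ← neg_add, neg_le_neg_iff, ← mul_add]
            refine mul_le_mul_of_nonneg_left ?_ hκ
            refine add_le_add ?_ (Finset.sum_le_sum fun i _ => ?_)
            · have := hN (u a) (w a)
              have h0 : 0 ≤ 8 * C * ∑ j ∈ insert a (t.filter good), inner ℝ (w j) (u a) ^ 2 :=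
                mul_nonneg (by positivity) (Finset.sum_nonneg fun _ _ => sq_nonneg _)
              linarith
            · rw [Finset.sum_insert hna]
              linarith
    · simp only [hga, if_false]
      rw [hI.lintegral_comp_pair (hm a) hTm (F := fun x T =>
        ENNReal.ofReal (Real.exp (-(Q (S₀ + T + x • w a) (S₀ + T + x • w a))))) (by
          refine Measurable.ennreal_ofReal (Real.measurable_exp.comp ?_)
          exact (hqc.measurable.comp (by fun_prop)).neg)]
      refine le_trans (lintegral_mono fun ω => ?_) (le_of_eq (lintegral_const _)) |>.trans
        (by rw [measure_univ, mul_one])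
      have := ih Q N hs hN hN0 hQ (S₀ + ξ a ω • w a)
      simpa only [add_right_comm] using this

end QuadraticForm

/-! ### Small ball estimate for the product of a random matrix and a fixed matrix -/

section BlockRow

variable {μ ν : Type*} [Fintype μ] [Fintype ν] [DecidableEq μ]

/-- The `μ × ν` array whose only nonzero row is the row `r`, which equals `v`. -/
noncomputable def blockRow (r : μ) (v : ν → ℝ) : EuclideanSpace ℝ (μ × ν) :=
  WithLp.toLp 2 fun a => if a.1 = r then v a.2 else 0

theorem inner_blockRow (r r' : μ) (v v' : ν → ℝ) :
    inner ℝ (blockRow r v) (blockRow r' v') = if r = r' then ∑ j, v j * v' j else 0 := by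
  rw [PiLp.inner_apply, Fintype.sum_prod_type, Finset.sum_eq_single r]
  · by_cases h : r = r' <;> simp [blockRow, h, mul_comm]
  · intro b _ hb
    simp [blockRow, hb]
  · simp

theorem norm_blockRow_sq (r : μ) (v : ν → ℝ) : ‖blockRow r v‖ ^ 2 = ∑ j, v j ^ 2 := by
  rw [← real_inner_self_eq_norm_sq, inner_blockRow, if_pos rfl]
  exact Finset.sum_congr rfl fun j _ => (sq (v j)).symm

/-- This puts `‖BY‖²` in the form required by the one-entry-at-a-time integration: a squared norm of
a sum with independent scalar coefficients. -/
theorem norm_sum_smul_blockRow_sq {η : Type*} [Fintype η] (B : Matrix μ η ℝ) (Y : Matrix η ν ℝ) :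
    ‖∑ a : μ × η, B a.1 a.2 • blockRow a.1 (Y a.2)‖ ^ 2 = ∑ r, ∑ j, (B * Y) r j ^ 2 := by
  rw [EuclideanSpace.real_norm_sq_eq, Fintype.sum_prod_type]
  refine Finset.sum_congr rfl fun r _ => Finset.sum_congr rfl fun j _ => ?_
  congr 1
  rw [WithLp.ofLp_sum, Finset.sum_apply, Fintype.sum_prod_type, Finset.sum_eq_single r]
  · simp [blockRow, Matrix.mul_apply]
  · intro b _ hb
    simp [blockRow, hb.symm]
  · simp

end BlockRow

/-! ### Overlap of the rows of `X` and `Y`, and the resulting Laplace transform bound -/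

section Overlap

variable {n l : ℕ} {X Y : Matrix (Fin n) (Fin l) ℝ}

/-- A row of `Y` with squared norm `y > 400` overlaps with that of `X` by at most `(5/4)√y ≤ y/16`.
Discarding such rows thus costs at most `4l/16` of the total overlap `l/2`. The quadratic penalty is
summed with the operator norm bound on `X`, giving `(25/16)·4l`. -/
theorem sum_good_rows_ge
    (hX : ∀ u : Fin l → ℝ, ∑ i, (∑ j, X i j * u j) ^ 2 ≤ 25 / 16 * ∑ j, u j ^ 2)
    (hX2 : ∑ i, ∑ j, X i j ^ 2 ≤ l) (hY : ∑ i, ∑ j, Y i j ^ 2 ≤ 4 * l)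
    (hXY : (l : ℝ) / 2 ≤ ∑ i, ∑ j, X i j * Y i j) {a b t : ℝ} (ha : 0 ≤ a) (hb : 0 ≤ b)
    (ht : 0 ≤ t) :
    l * (t / 2 - t ^ 2 * (a + 25 / 4 * b)) ≤
      ∑ i, if ∑ j, Y i j ^ 2 ≤ 400 then 2 * t * ∑ j, X i j * Y i j - t ^ 2 * a * ∑ j, X i j ^ 2
        - t ^ 2 * b * ∑ i', (∑ j, Y i' j * X i j) ^ 2 else 0 := by
  have hrow (i : Fin n) : (∑ j, X i j * Y i j) ^ 2 ≤ 25 / 16 * ∑ j, Y i j ^ 2 :=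
    (Finset.single_le_sum (f := fun i' => (∑ j, X i' j * Y i j) ^ 2) (fun _ _ => sq_nonneg _)
      (Finset.mem_univ i)).trans (hX (Y i))
  have hD : ∑ i, ∑ i', (∑ j, Y i' j * X i j) ^ 2 ≤ 25 / 4 * l := by
    rw [Finset.sum_comm]
    calc _ ≤ ∑ i', 25 / 16 * ∑ j, Y i' j ^ 2 := Finset.sum_le_sum fun i' _ => by
          simpa only [mul_comm] using hX (Y i')
      _ ≤ _ := by rw [← Finset.mul_sum]; linarith
  have hterm (i : Fin n) : 2 * t * (∑ j, X i j * Y i j - 1 / 16 * ∑ j, Y i j ^ 2)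
      - t ^ 2 * a * ∑ j, X i j ^ 2 - t ^ 2 * b * ∑ i', (∑ j, Y i' j * X i j) ^ 2 ≤
      if ∑ j, Y i j ^ 2 ≤ 400 then 2 * t * ∑ j, X i j * Y i j - t ^ 2 * a * ∑ j, X i j ^ 2
        - t ^ 2 * b * ∑ i', (∑ j, Y i' j * X i j) ^ 2 else 0 := by
    have h1 : 0 ≤ ∑ j, Y i j ^ 2 := Finset.sum_nonneg fun _ _ => sq_nonneg _
    have h2 : 0 ≤ t ^ 2 * a * ∑ j, X i j ^ 2 :=
      mul_nonneg (by positivity) (Finset.sum_nonneg fun _ _ => sq_nonneg _)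
    have h3 : 0 ≤ t ^ 2 * b * ∑ i', (∑ j, Y i' j * X i j) ^ 2 :=
      mul_nonneg (by positivity) (Finset.sum_nonneg fun _ _ => sq_nonneg _)
    split_ifs with h
    · nlinarith
    · have h4 : ∑ j, X i j * Y i j ≤ 1 / 16 * ∑ j, Y i j ^ 2 := by
        refine abs_le_of_sq_le_sq' ?_ (by linarith) |>.2
        push Not at h
        nlinarith [hrow i]
      have : t * (∑ j, X i j * Y i j - 1 / 16 * ∑ j, Y i j ^ 2) ≤ 0 :=
        mul_nonpos_of_nonneg_of_nonpos ht (by linarith)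
      linarith
  refine le_trans ?_ (Finset.sum_le_sum fun i _ => hterm i)
  simp only [Finset.sum_sub_distrib, ← Finset.mul_sum]
  have e1 : t ^ 2 * a * ∑ i, ∑ j, X i j ^ 2 ≤ t ^ 2 * a * l :=
    mul_le_mul_of_nonneg_left hX2 (by positivity)
  have e2 : t ^ 2 * b * ∑ i, ∑ i', (∑ j, Y i' j * X i j) ^ 2 ≤ t ^ 2 * b * (25 / 4 * l) :=
    mul_le_mul_of_nonneg_left hD (by positivity)
  have e3 : 2 * t * ((l : ℝ) / 4) ≤
      2 * t * (∑ i, ∑ j, X i j * Y i j - 1 / 16 * ∑ i, ∑ j, Y i j ^ 2) :=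
    mul_le_mul_of_nonneg_left (by linarith) (by positivity)
  linarith

variable {Ω : Type*} [MeasurableSpace Ω] {P : Measure Ω} [IsProbabilityMeasure P]

theorem lintegral_exp_neg_mul_le {m : ℕ} {B : Ω → Matrix (Fin m) (Fin n) ℝ}
    (hind : iIndepFun (fun (a : Fin m × Fin n) ω => B ω a.1 a.2) P)
    (hm : ∀ i j, Measurable fun ω => B ω i j) {C κ lam : ℝ} (hC : 0 ≤ C) (hκ : 0 ≤ κ)
    (hξ : ∀ i j a x, 0 ≤ x → x ≤ 1 / 2 →
      ∫⁻ ω, ENNReal.ofReal (Real.exp (a * B ω i j - x * B ω i j ^ 2)) ∂P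
        ≤ ENNReal.ofReal (Real.exp (C * a ^ 2 - κ * x)))
    (hlam : 0 < lam) (hlam1 : lam * 400 ≤ 1 / 2) (hlam2 : 4 * C * (lam * 400) ≤ 1 / 2)
    (hX : ∀ u : Fin l → ℝ, ∑ i, (∑ j, X i j * u j) ^ 2 ≤ 25 / 16 * ∑ j, u j ^ 2)
    (hX2 : ∑ i, ∑ j, X i j ^ 2 ≤ l) (hY : ∑ i, ∑ j, Y i j ^ 2 ≤ 4 * l)
    (hXY : (l : ℝ) / 2 ≤ ∑ i, ∑ j, X i j * Y i j) :
    ∫⁻ ω, ENNReal.ofReal (Real.exp (-(lam * ∑ r, ∑ j, (B ω * Y) r j ^ 2))) ∂P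
      ≤ ENNReal.ofReal (Real.exp (-(κ / (16 * (1 / lam + 50 * C)) * m * l))) := by
  -- With test vectors scaled by `t`, each row of `B` gains `l(t/2 - c t²)`, where `50 C =
  -- (25/4)·8C`. The maximum, at `t = 1/(4c)`, is `l/(16c)`.
  set c := 1 / lam + 50 * C with hc
  have hc0 : 0 < c := by positivity
  set t := 1 / (4 * c) with ht
  have ht0 : 0 < t := by positivity
  let Q : EuclideanSpace ℝ (Fin m × Fin l) →L[ℝ] EuclideanSpace ℝ (Fin m × Fin l) →L[ℝ] ℝ :=
    lam • innerSL ℝ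
  have hQa (x y) : Q x y = lam * inner ℝ x y := rfl
  have key := lintegral_exp_neg_quadratic_le hind (fun a => hm a.1 a.2) hC hκ
    (fun a => hξ a.1 a.2) (lam := lam) (fun a : Fin m × Fin n => blockRow a.1 (Y a.2))
    (fun a => t • blockRow a.1 (X a.2)) (fun a => ∑ j, Y a.2 j ^ 2 ≤ 400)
    (fun a ha => by
      rw [norm_blockRow_sq]
      constructor
      · nlinarith
      · have : lam * ∑ j, Y a.2 j ^ 2 ≤ lam * 400 := mul_le_mul_of_nonneg_left ha hlam.le
        nlinarith)
    Finset.univ Q (fun u => 1 / lam * ‖u‖ ^ 2)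
    (fun x y => by rw [hQa, hQa, real_inner_comm])
    (fun u S => by
      rw [hQa, real_inner_self_eq_norm_sq]
      have h := sq_nonneg ‖lam • S - u‖
      rw [norm_sub_sq_real, norm_smul, real_inner_smul_left, real_inner_comm, mul_pow,
        Real.norm_eq_abs, sq_abs] at h
      have : 1 / lam * (lam ^ 2 * ‖S‖ ^ 2 - 2 * (lam * inner ℝ u S) + ‖u‖ ^ 2) =
        lam * ‖S‖ ^ 2 - 2 * inner ℝ u S + 1 / lam * ‖u‖ ^ 2 := by field_simp
      have h' : 0 ≤ 1 / lam * (lam ^ 2 * ‖S‖ ^ 2 - 2 * (lam * inner ℝ u S) + ‖u‖ ^ 2) :=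
        mul_nonneg (by positivity) h
      linarith)
    (by simp)
    (fun S => by rw [hQa, real_inner_self_eq_norm_sq]) 0
  simp only [hQa, zero_add, real_inner_self_eq_norm_sq, norm_sum_smul_blockRow_sq] at key
  refine key.trans (ENNReal.ofReal_le_ofReal (Real.exp_le_exp.2 ?_))
  rw [neg_le_neg_iff, div_mul_eq_mul_div, div_mul_eq_mul_div, mul_assoc, mul_div_assoc]
  refine mul_le_mul_of_nonneg_left ?_ hκ
  have hsum := sum_good_rows_ge hX hX2 hY hXY (a := 1 / lam) (b := 8 * C) (by positivity)
    (by positivity) ht0.le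
  have e : (m : ℝ) * l / (16 * c) = ∑ _r : Fin m, l * (t / 2 - t ^ 2 * (1 / lam +
      25 / 4 * (8 * C))) := by
    rw [Finset.sum_const, Finset.card_univ, Fintype.card_fin, nsmul_eq_mul,
      show 1 / lam + 25 / 4 * (8 * C) = c by rw [hc]; ring, ht]
    field_simp
    norm_num
  rw [e, Finset.sum_filter, Fintype.sum_prod_type]
  refine Finset.sum_le_sum fun r _ => hsum.trans (Finset.sum_le_sum fun i _ => ?_)
  split_ifs with h
  · rw [real_inner_smul_left, inner_blockRow, if_pos rfl, norm_smul, mul_pow, norm_blockRow_sq,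
      Real.norm_eq_abs, sq_abs]
    have h1 : ∑ a : Fin m × Fin n with ∑ j, Y a.2 j ^ 2 ≤ 400,
        inner ℝ (blockRow a.1 (Y a.2)) (t • blockRow r (X i)) ^ 2 ≤
        t ^ 2 * ∑ i', (∑ j, Y i' j * X i j) ^ 2 := by
      calc _ ≤ ∑ a : Fin m × Fin n, inner ℝ (blockRow a.1 (Y a.2)) (t • blockRow r (X i)) ^ 2 :=
            Finset.sum_le_sum_of_subset_of_nonneg (Finset.filter_subset _ _)
              fun _ _ _ => sq_nonneg _
        _ = _ := by
            rw [Fintype.sum_prod_type, Finset.sum_eq_single r]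
            · rw [Finset.mul_sum]
              refine Finset.sum_congr rfl fun i' _ => ?_
              rw [real_inner_smul_right, inner_blockRow, if_pos rfl, mul_pow]
            · intro b _ hb
              simp [real_inner_smul_right, inner_blockRow, hb]
            · simp
    have h2 := mul_le_mul_of_nonneg_left h1 (by positivity : 0 ≤ 8 * C)
    linarith
  · exact le_rfl

end Overlap

/-! ### Rounding to a lattice -/

/-- If each `z i` is independently `e₀ i` or `e₁ i` with probabilities `1 - p i` and `p i`, the
errors have mean zero, the cross terms vanish, and the right side is the expectation of the left.
Choosing one coordinate at a time never exceeds the mean. -/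
theorem exists_rounding {ι F : Type*} [DecidableEq ι] [NormedAddCommGroup F]
    [InnerProductSpace ℝ F] (b : ι → F) (e₀ e₁ : ι → ℤ) (p : ι → ℝ) (hp0 : ∀ i, 0 ≤ p i)
    (hp1 : ∀ i, p i ≤ 1) (d g : ι → ℤ → ℝ)
    (hd : ∀ i, (1 - p i) * d i (e₀ i) + p i * d i (e₁ i) = 0) (t : Finset ι) :
    ∃ z : ι → ℤ, ‖∑ i ∈ t, d i (z i) • b i‖ ^ 2 + ∑ i ∈ t, g i (z i) ≤
      ∑ i ∈ t, ((1 - p i) * (d i (e₀ i) ^ 2 * ‖b i‖ ^ 2 + g i (e₀ i)) +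
        p i * (d i (e₁ i) ^ 2 * ‖b i‖ ^ 2 + g i (e₁ i))) := by
  induction t using Finset.induction_on with
  | empty => exact ⟨0, by simp⟩
  | insert a t ha ih =>
    obtain ⟨z, hz⟩ := ih
    set S := ∑ i ∈ t, d i (z i) • b i with hS
    have upd (k : ℤ) : ‖∑ i ∈ insert a t, d i (Function.update z a k i) • b i‖ ^ 2 +
        ∑ i ∈ insert a t, g i (Function.update z a k i) = ‖S‖ ^ 2 + ∑ i ∈ t, g i (z i) +
        (2 * inner ℝ (b a) S * d a k + (d a k ^ 2 * ‖b a‖ ^ 2 + g a k)) := by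
      have h1 : ∑ i ∈ t, d i (Function.update z a k i) • b i = S :=
        Finset.sum_congr rfl fun i hi => by
          rw [Function.update_of_ne (ne_of_mem_of_not_mem hi ha)]
      have h2 : ∑ i ∈ t, g i (Function.update z a k i) = ∑ i ∈ t, g i (z i) :=
        Finset.sum_congr rfl fun i hi => by
          rw [Function.update_of_ne (ne_of_mem_of_not_mem hi ha)]
      rw [Finset.sum_insert ha, Finset.sum_insert ha, h1, h2, Function.update_self,
        norm_add_sq_real, norm_smul, mul_pow, Real.norm_eq_abs, sq_abs, real_inner_smul_left]
      ring
    rw [Finset.sum_insert ha]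
    by_contra! hcon
    have c0 := hcon (Function.update z a (e₀ a))
    have c1 := hcon (Function.update z a (e₁ a))
    rw [upd] at c0 c1
    have m0 := mul_le_mul_of_nonneg_left c0.le (sub_nonneg.2 (hp1 a))
    have m1 := mul_le_mul_of_nonneg_left c1.le (hp0 a)
    have hda : 2 * inner ℝ (b a) S * ((1 - p a) * d a (e₀ a) + p a * d a (e₁ a)) = 0 := by
      rw [hd, mul_zero]
    -- The average of the two strict inequalities is contradictory as soon as one with positive
    -- weight is kept strict.
    rcases (hp0 a).lt_or_eq with h | h
    · have m1' := mul_lt_mul_of_pos_left c1 h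
      nlinarith
    · have m0' := mul_lt_mul_of_pos_left c0 (by rw [← h]; norm_num : 0 < 1 - p a)
      nlinarith

/-- The weight `a [k ≠ 0] + b |k|` of an integer. -/
noncomputable def latticeCost (a b : ℝ) (k : ℤ) : ℝ := (if k = 0 then 0 else a) + b * |(k : ℝ)|

theorem latticeCost_nonneg {a b : ℝ} (ha : 0 ≤ a) (hb : 0 ≤ b) (k : ℤ) :
    0 ≤ latticeCost a b k := by
  unfold latticeCost
  split_ifs <;> positivity

theorem expected_abs_rounding (t : ℝ) :
    (1 - Int.fract t) * |((⌊t⌋ : ℤ) : ℝ)| + Int.fract t * |((⌊t⌋ + 1 : ℤ) : ℝ)| = |t| := by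
  have h := Int.self_sub_floor t
  rcases le_or_gt 0 t with h0 | h0
  · have h1 : (0 : ℝ) ≤ ⌊t⌋ := by exact_mod_cast Int.floor_nonneg.2 h0
    push_cast
    rw [abs_of_nonneg h1, abs_of_nonneg (by linarith : (0 : ℝ) ≤ ⌊t⌋ + 1), abs_of_nonneg h0, ← h]
    ring
  · have h1 : ((⌊t⌋ + 1 : ℤ) : ℝ) ≤ 0 := by
      have : ⌊t⌋ < 0 := Int.floor_lt.2 (by simpa using h0)
      exact_mod_cast this
    rw [abs_of_nonpos h1]
    push_cast at h1 ⊢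
    rw [abs_of_nonpos (by linarith : (⌊t⌋ : ℝ) ≤ 0), abs_of_neg h0, ← h]
    ring

/-- The two neighbours of `t` lie on the same side of 0, so the rounded value has mean absolute
value `|t|`. It is nonzero with probability at most `min 1 |t|`. -/
theorem expected_latticeCost_le {a b : ℝ} (ha : 0 ≤ a) (t : ℝ) :
    (1 - Int.fract t) * latticeCost a b ⌊t⌋ + Int.fract t * latticeCost a b (⌊t⌋ + 1) ≤
      a * min 1 |t| + b * |t| := by
  have h0 := Int.fract_nonneg t
  have h1 := (Int.fract_lt_one t).le
  have e := expected_abs_rounding t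
  have ind (k : ℤ) : (if k = 0 then 0 else a) ≤ a * |(k : ℝ)| := by
    split_ifs with h
    · positivity
    · have : (1 : ℝ) ≤ |(k : ℝ)| := by exact_mod_cast Int.one_le_abs h
      nlinarith
  have ind' (k : ℤ) : (if k = 0 then 0 else a) ≤ a := by split_ifs <;> linarith
  have A : (1 - Int.fract t) * (if ⌊t⌋ = 0 then 0 else a) +
      Int.fract t * (if ⌊t⌋ + 1 = 0 then 0 else a) ≤ a * min 1 |t| := by
    have m1 := mul_le_mul_of_nonneg_left (ind ⌊t⌋) (sub_nonneg.2 h1)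
    have m2 := mul_le_mul_of_nonneg_left (ind (⌊t⌋ + 1)) h0
    have m3 := mul_le_mul_of_nonneg_left (ind' ⌊t⌋) (sub_nonneg.2 h1)
    have m4 := mul_le_mul_of_nonneg_left (ind' (⌊t⌋ + 1)) h0
    rcases le_total 1 |t| with h | h
    · rw [min_eq_left h]; linarith
    · rw [min_eq_right h, ← e]; linarith
  have eb : b * ((1 - Int.fract t) * |((⌊t⌋ : ℤ) : ℝ)| +
      Int.fract t * |((⌊t⌋ + 1 : ℤ) : ℝ)|) = b * |t| := by rw [e]
  unfold latticeCost
  linarith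

theorem exists_lattice_approx {n : ℕ} {F : Type*} [NormedAddCommGroup F]
    [InnerProductSpace ℝ F] (v : Fin n → F) (x : Fin n → ℝ) {h a b A D : ℝ} (hh : 0 < h)
    (ha : 0 ≤ a) (hA : 0 ≤ A) (hD : 0 ≤ D) :
    ∃ z : Fin n → ℤ, ‖∑ i, (h * z i - x i) • v i‖ ^ 2 + A * ∑ i, latticeCost a b (z i) +
        D * ∑ i, (h * z i - x i) ^ 2 ≤
      h ^ 2 / 4 * ∑ i, ‖v i‖ ^ 2 + A * (a * ∑ i, min 1 |x i / h| + b * ∑ i, |x i / h|) +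
        D * (n * (h ^ 2 / 4)) := by
  obtain ⟨z, hz⟩ := exists_rounding v (fun i => ⌊x i / h⌋) (fun i => ⌊x i / h⌋ + 1)
    (fun i => Int.fract (x i / h)) (fun i => Int.fract_nonneg _)
    (fun i => (Int.fract_lt_one _).le) (fun i k => h * k - x i)
    (fun i k => A * latticeCost a b k + D * (h * k - x i) ^ 2)
    (fun i => by
      rw [← Int.self_sub_floor]
      push_cast
      field_simp
      ring) Finset.univ
  refine ⟨z, ?_⟩
  rw [Finset.sum_add_distrib, ← Finset.mul_sum, ← Finset.mul_sum, ← add_assoc] at hz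
  refine hz.trans ?_
  have hn : (n : ℝ) * (h ^ 2 / 4) = ∑ _i : Fin n, h ^ 2 / 4 := by simp
  rw [hn]
  simp only [Finset.mul_sum, ← Finset.sum_add_distrib]
  refine Finset.sum_le_sum fun i _ => ?_
  have hx : x i = h * (⌊x i / h⌋ + Int.fract (x i / h)) := by
    rw [Int.floor_add_fract]; field_simp
  have c1 := expected_latticeCost_le (b := b) ha (x i / h)
  set q := Int.fract (x i / h)
  have e : (1 - q) * (h * ⌊x i / h⌋ - x i) ^ 2 +
      q * (h * (⌊x i / h⌋ + 1 : ℤ) - x i) ^ 2 = h ^ 2 * (q * (1 - q)) := by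
    have d0 : h * ⌊x i / h⌋ - x i = -(h * q) := by linarith
    have d1 : h * (⌊x i / h⌋ + 1 : ℤ) - x i = h * (1 - q) := by push_cast; linarith
    rw [d0, d1]
    ring
  have e2 : h ^ 2 * (q * (1 - q)) ≤ h ^ 2 / 4 := by nlinarith [sq_nonneg (q - 1 / 2), sq_nonneg h]
  rw [← e] at e2
  have m1 := mul_le_mul_of_nonneg_right e2 (sq_nonneg ‖v i‖)
  have m2 := mul_le_mul_of_nonneg_left e2 hD
  have m3 := mul_le_mul_of_nonneg_left c1 hA
  linarith

theorem sum_exp_neg_mul_le {b : ℝ} (M : ℕ) :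
    b * ∑ k ∈ Finset.range M, Real.exp (-(b * (k + 1))) ≤ 1 - Real.exp (-(b * M)) := by
  induction M with
  | zero => simp
  | succ M ih =>
    rw [Finset.sum_range_succ, mul_add]
    have h : Real.exp (-(b * M)) = Real.exp b * Real.exp (-(b * (M + 1))) := by
      rw [← Real.exp_add]; ring_nf
    have := mul_le_mul_of_nonneg_right (Real.add_one_le_exp b) (Real.exp_pos (-(b * (M + 1)))).le
    push_cast
    linarith

theorem sum_exp_neg_latticeCost_le {a b : ℝ} (hb : 0 < b) (M : ℕ) :
    ∑ k ∈ Finset.Icc (-(M : ℤ)) M, Real.exp (-latticeCost a b k) ≤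
      1 + 2 * Real.exp (-a) / b := by
  have h1 : ∑ k ∈ Finset.Icc (-(M : ℤ)) M, Real.exp (-latticeCost a b k) =
      1 + 2 * Real.exp (-a) * ∑ k ∈ Finset.range M, Real.exp (-(b * (k + 1))) := by
    induction M with
    | zero => simp [latticeCost]
    | succ M ih =>
      have e : Finset.Icc (-((M + 1 : ℕ) : ℤ)) ((M + 1 : ℕ) : ℤ) =
          insert ((M : ℤ) + 1) (insert (-((M : ℤ) + 1)) (Finset.Icc (-(M : ℤ)) M)) := by
        ext k
        simp only [Finset.mem_insert, Finset.mem_Icc]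
        push_cast
        omega
      have p1 : (0 : ℝ) ≤ (M : ℝ) + 1 := by positivity
      have c1 : latticeCost a b ((M : ℤ) + 1) = a + b * (M + 1) := by
        unfold latticeCost
        rw [if_neg (by omega)]
        push_cast
        rw [abs_of_nonneg p1]
      have c2 : latticeCost a b (-((M : ℤ) + 1)) = a + b * (M + 1) := by
        unfold latticeCost
        rw [if_neg (by omega)]
        push_cast
        rw [abs_neg, abs_of_nonneg p1]
      rw [e, Finset.sum_insert (by simp; omega), Finset.sum_insert (by simp), ih,
        Finset.sum_range_succ, c1, c2, neg_add, Real.exp_add]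
      ring
  have h2 : ∑ k ∈ Finset.range M, Real.exp (-(b * (k + 1))) ≤ 1 / b := by
    rw [le_div_iff₀' hb]
    exact (sum_exp_neg_mul_le M).trans (by linarith [Real.exp_pos (-(b * M))])
  rw [h1, mul_div_assoc, mul_assoc]
  have := mul_le_mul_of_nonneg_left h2 (Real.exp_pos (-a)).le
  rw [mul_one_div] at this
  linarith

theorem Real.exp_neg_one_div_le {τ : ℝ} (hτ : 0 < τ) : Real.exp (-(1 / τ)) ≤ 24 * τ ^ 4 := by
  have h := Real.pow_div_factorial_le_exp (1 / τ) (by positivity) 4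
  rw [Real.exp_neg]
  refine inv_le_of_inv_le₀ (by positivity) (le_trans (le_of_eq ?_) h)
  norm_num [Nat.factorial]
  field_simp

/-- The price `1/τ` of a nonzero coordinate beats the `O(τ⁻³)` values that the cheap linear term
leaves open. -/
theorem sum_exp_neg_latticeCost_le_exp {τ : ℝ} (hτ : 0 < τ) (M : ℕ) :
    ∑ k ∈ Finset.Icc (-(M : ℤ)) M, Real.exp (-latticeCost (1 / τ) (τ ^ 3) k) ≤
      Real.exp (48 * τ) := by
  refine (sum_exp_neg_latticeCost_le (by positivity) M).trans ?_
  have h : 2 * Real.exp (-(1 / τ)) / τ ^ 3 ≤ 48 * τ := by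
    rw [div_le_iff₀ (by positivity)]
    nlinarith [Real.exp_neg_one_div_le hτ]
  linarith [Real.add_one_le_exp (48 * τ)]

theorem sum_abs_le_sqrt {n : ℕ} (x : EuclideanSpace ℝ (Fin n)) :
    ∑ i, |x i| ≤ √n * ‖x‖ := by
  refine abs_le_of_sq_le_sq' ?_ (by positivity) |>.2
  rw [mul_pow, Real.sq_sqrt (by positivity), EuclideanSpace.real_norm_sq_eq]
  have := sq_sum_le_card_mul_sum_sq (s := Finset.univ) (f := fun i => |x i|)
  simpa using this

/-- Compressible vectors are close to lattice vectors of small weight. -/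
theorem exists_lattice_approx_compressible {m n : ℕ} (hn : 0 < n) {τ R : ℝ} (hτ : 0 < τ)
    (hτ1 : τ ≤ 1) (hR : 0 < R) (B : Matrix (Fin m) (Fin n) ℝ)
    (hB : ∑ r, ∑ i, B r i ^ 2 ≤ R * n ^ 2) {x : EuclideanSpace ℝ (Fin n)}
    (hx : x ∈ compressibleVectors n (τ ^ 2 * n) (τ ^ 4)) :
    ∃ z : Fin n → ℤ, ∑ i, latticeCost (1 / τ) (τ ^ 3) (z i) ≤ 12 * τ * n ∧
      ∑ i, (τ / √n * z i - x i) ^ 2 ≤ τ ^ 2 ∧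
      ∑ r, (∑ i, B r i * (τ / √n * z i - x i)) ^ 2 ≤ R * τ ^ 2 * n := by
  obtain ⟨hx1, hx2⟩ := hx
  have hn0 : (0 : ℝ) < n := by exact_mod_cast hn
  have hsn : 0 < √(n : ℝ) := Real.sqrt_pos.2 hn0
  have hsq : √(n : ℝ) * √n = n := Real.mul_self_sqrt hn0.le
  have h0 : (0 : EuclideanSpace ℝ (Fin n)) ∈ sparseVectors n (τ ^ 2 * n) := by
    simp only [sparseVectors, Set.mem_ofPred_eq, PiLp.zero_apply, Function.support_fun_zero,
      Set.ncard_empty, Nat.cast_zero]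
    positivity
  -- The slack `2τ⁴` yields an actual sparse vector without attaining the infimum.
  obtain ⟨y, hy, hxy⟩ := (Metric.infDist_lt_iff ⟨0, h0⟩).1
    (hx2.trans_lt (by have := pow_pos hτ 4; linarith : τ ^ 4 < 2 * τ ^ 4))
  set h := τ / √(n : ℝ) with hh
  have hh0 : 0 < h := by positivity
  have hh2 : h ^ 2 = τ ^ 2 / n := by rw [hh, div_pow, Real.sq_sqrt hn0.le]
  set v : Fin n → EuclideanSpace ℝ (Fin m) := fun i => WithLp.toLp 2 fun r => B r i with hv
  have hvn : ∑ i, ‖v i‖ ^ 2 ≤ R * n ^ 2 := by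
    refine le_trans (le_of_eq ?_) hB
    rw [Finset.sum_comm]
    simp [EuclideanSpace.real_norm_sq_eq, hv]
  -- The weights `A` and `D` make the mean of each of the three terms at most `Rτ²n/4`. One `z` then
  -- controls all three at once, and the cost bound is `(3/4)Rτ²n / (Rτ/16) = 12τn`.
  obtain ⟨z, hz⟩ := exists_lattice_approx v (fun i => x i) (a := 1 / τ) (b := τ ^ 3)
    (A := R * τ / 16) (D := R * n) hh0 (by positivity) (by positivity) (by positivity)
  have hcost : ∀ i, 0 ≤ latticeCost (1 / τ) (τ ^ 3) (z i) := fun i =>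
    latticeCost_nonneg (by positivity) (by positivity) _
  have habs : ∑ i, |x i / h| ≤ n / τ := by
    simp only [abs_div, abs_of_pos hh0, ← Finset.sum_div]
    rw [div_le_div_iff₀ hh0 hτ, hh]
    have := sum_abs_le_sqrt x
    rw [hx1, mul_one] at this
    calc (∑ i, |x i|) * τ ≤ √n * τ := by gcongr
      _ = √n * √n * (τ / √n) := by field_simp
      _ = n * (τ / √n) := by rw [hsq]
  have hmin : ∑ i, min 1 |x i / h| ≤ τ ^ 2 * n + 2 * τ ^ 3 * n := by
    classical
    -- On the support of the sparse `y` the minimum is at most 1; elsewhere `x` equals `x - y`.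
    have pt (i : Fin n) : min 1 |x i / h| ≤ (if y i ≠ 0 then 1 else 0) + |(x - y) i| / h := by
      have : 0 ≤ |(x - y) i| / h := by positivity
      split_ifs with hi
      · linarith [min_le_left 1 |x i / h|]
      · push Not at hi
        rw [PiLp.sub_apply, hi, sub_zero, zero_add]
        exact (min_le_right _ _).trans (by rw [abs_div, abs_of_pos hh0])
    refine (Finset.sum_le_sum fun i _ => pt i).trans ?_
    rw [Finset.sum_add_distrib, ← Finset.sum_div]
    refine add_le_add ?_ ?_
    · refine le_trans (le_of_eq ?_) hy
      rw [Finset.sum_boole, Set.ncard_eq_toFinset_card']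
      congr 2
      ext i
      simp
    · rw [div_le_iff₀ hh0]
      refine (sum_abs_le_sqrt (x - y)).trans ?_
      rw [dist_eq_norm] at hxy
      calc √n * ‖x - y‖ ≤ √n * (2 * τ ^ 4) := by gcongr
        _ = 2 * τ ^ 3 * (√n * √n) * (τ / √n) := by field_simp
        _ = _ := by rw [hsq]
  have hτ2 : τ ^ 2 ≤ τ := by nlinarith
  have hrhs : h ^ 2 / 4 * ∑ i, ‖v i‖ ^ 2 + R * τ / 16 * (1 / τ * ∑ i, min 1 |x i / h| +
      τ ^ 3 * ∑ i, |x i / h|) + R * n * (n * (h ^ 2 / 4)) ≤ 3 / 4 * (R * τ ^ 2 * n) := by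
    have t1 : h ^ 2 / 4 * ∑ i, ‖v i‖ ^ 2 ≤ 1 / 4 * (R * τ ^ 2 * n) := by
      calc _ ≤ h ^ 2 / 4 * (R * n ^ 2) := by gcongr
        _ = _ := by rw [hh2]; field_simp
    have t3 : R * n * (n * (h ^ 2 / 4)) = 1 / 4 * (R * τ ^ 2 * n) := by
      rw [hh2]; field_simp
    have t2 : 1 / τ * ∑ i, min 1 |x i / h| + τ ^ 3 * ∑ i, |x i / h| ≤ 4 * τ * n := by
      calc _ ≤ 1 / τ * (τ ^ 2 * n + 2 * τ ^ 3 * n) + τ ^ 3 * (n / τ) := by gcongr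
        _ = (τ + 3 * τ ^ 2) * n := by field_simp; ring
        _ ≤ _ := by gcongr; linarith
    have t2' : R * τ / 16 * (1 / τ * ∑ i, min 1 |x i / h| + τ ^ 3 * ∑ i, |x i / h|) ≤
        1 / 4 * (R * τ ^ 2 * n) := by
      calc _ ≤ R * τ / 16 * (4 * τ * n) := by gcongr
        _ = _ := by ring
    linarith
  have hz' := hz.trans hrhs
  have s1 : 0 ≤ ‖∑ i, (h * z i - x i) • v i‖ ^ 2 := by positivity
  have s2 : 0 ≤ R * τ / 16 * ∑ i, latticeCost (1 / τ) (τ ^ 3) (z i) :=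
    mul_nonneg (by positivity) (Finset.sum_nonneg fun i _ => hcost i)
  have s3 : 0 ≤ R * n * ∑ i, (h * z i - x i) ^ 2 :=
    mul_nonneg (by positivity) (Finset.sum_nonneg fun i _ => sq_nonneg _)
  have s4 : 0 ≤ R * τ ^ 2 * n := by positivity
  refine ⟨z, ?_, ?_, ?_⟩
  · refine le_of_mul_le_mul_left (a := R * τ / 16) ?_ (by positivity)
    calc _ ≤ 3 / 4 * (R * τ ^ 2 * n) := by linarith
      _ = _ := by ring
  · refine le_of_mul_le_mul_left (a := R * n) ?_ (by positivity)
    calc _ ≤ R * τ ^ 2 * n := by linarith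
      _ = _ := by ring
  · have e : ‖∑ i, (h * z i - x i) • v i‖ ^ 2 = ∑ r, (∑ i, B r i * (h * z i - x i)) ^ 2 := by
      rw [EuclideanSpace.real_norm_sq_eq]
      refine Finset.sum_congr rfl fun r _ => ?_
      rw [WithLp.ofLp_sum, Finset.sum_apply]
      congr 1
      exact Finset.sum_congr rfl fun i _ => by simp [hv, mul_comm]
    rw [← e]
    linarith

/-! ### Operator norm and the largest singular value -/

/-- Expand `u` in an orthonormal eigenbasis of `T* T`, whose eigenvalues are the squared singular
values. -/
theorem LinearMap.norm_apply_sq_le_singularValues {E F : Type*} [NormedAddCommGroup E]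
    [InnerProductSpace ℝ E] [FiniteDimensional ℝ E] [NormedAddCommGroup F]
    [InnerProductSpace ℝ F] [FiniteDimensional ℝ F] (T : E →ₗ[ℝ] F) (u : E) :
    ‖T u‖ ^ 2 ≤ T.singularValues 0 ^ 2 * ‖u‖ ^ 2 := by
  have hT := T.isSymmetric_adjoint_comp_self
  set e := hT.eigenvectorBasis rfl with he
  have h1 : ‖T u‖ ^ 2 = inner ℝ ((adjoint T ∘ₗ T) u) u := by
    rw [LinearMap.comp_apply, LinearMap.adjoint_inner_left, real_inner_self_eq_norm_sq]
  have h2 : ‖u‖ ^ 2 = ∑ i, inner ℝ u (e i) * inner ℝ (e i) u := by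
    rw [e.sum_inner_mul_inner, real_inner_self_eq_norm_sq]
  rw [h1, ← e.sum_inner_mul_inner, h2, Finset.mul_sum]
  refine Finset.sum_le_sum fun i _ => ?_
  have h3 : inner ℝ ((adjoint T ∘ₗ T) u) (e i) = T.singularValues i ^ 2 * inner ℝ u (e i) := by
    rw [hT, hT.apply_eigenvectorBasis rfl i, real_inner_smul_right, T.sq_singularValues_fin rfl i]
    rfl
  have h4 : T.singularValues i ^ 2 ≤ T.singularValues 0 ^ 2 :=
    pow_le_pow_left₀ (T.singularValues_nonneg i) (T.singularValues_antitone (Nat.zero_le i)) 2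
  rw [h3, mul_assoc]
  refine mul_le_mul_of_nonneg_right h4 ?_
  rw [real_inner_comm]
  exact mul_self_nonneg _

/-! ### The Hilbert-Schmidt norm of a random matrix -/

section HilbertSchmidt

variable {Ω : Type*} [MeasurableSpace Ω] {P : Measure Ω}

theorem measure_exp_markov {Z : Ω → ℝ} {t e : ℝ}
    (h : ∫⁻ ω, ENNReal.ofReal (Real.exp (Z ω)) ∂P ≤ ENNReal.ofReal (Real.exp e))
    (hZ : Measurable Z) : P {ω | t ≤ Z ω} ≤ ENNReal.ofReal (Real.exp (e - t)) := by
  have hm := mul_meas_ge_le_lintegral (μ := P) (f := fun ω => ENNReal.ofReal (Real.exp (Z ω)))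
    (by fun_prop) (ENNReal.ofReal (Real.exp t))
  have hset : {ω | ENNReal.ofReal (Real.exp t) ≤ ENNReal.ofReal (Real.exp (Z ω))} =
      {ω | t ≤ Z ω} := by
    ext ω
    simp [ENNReal.ofReal_le_ofReal_iff (Real.exp_pos _).le]
  rw [hset] at hm
  calc P {ω | t ≤ Z ω} = ENNReal.ofReal (Real.exp (-t)) *
        (ENNReal.ofReal (Real.exp t) * P {ω | t ≤ Z ω}) := by
        rw [← mul_assoc, ← ENNReal.ofReal_mul (Real.exp_pos _).le, ← Real.exp_add]
        simp
    _ ≤ ENNReal.ofReal (Real.exp (-t)) * ENNReal.ofReal (Real.exp e) := by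
        gcongr
        exact hm.trans h
    _ = _ := by
        rw [← ENNReal.ofReal_mul (Real.exp_pos _).le, ← Real.exp_add, neg_add_eq_sub]

/-- By independence the exponential moment of the sum factors, and each factor is at most `2 ≤ e`;
Markov's inequality finishes. -/
theorem measure_sum_sq_ge_le {ι : Type*} [Fintype ι] {ξ : ι → Ω → ℝ}
    (hind : iIndepFun ξ P) (hm : ∀ i, Measurable (ξ i)) {s : ℝ} (hs : 0 < s)
    (h2 : ∀ i, ∫⁻ ω, ENNReal.ofReal (Real.exp ((ξ i ω / s) ^ 2)) ∂P ≤ 2) (t : ℝ) :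
    P {ω | s ^ 2 * t ≤ ∑ i, ξ i ω ^ 2} ≤
      ENNReal.ofReal (Real.exp (Fintype.card ι - t)) := by
  have hset : {ω | s ^ 2 * t ≤ ∑ i, ξ i ω ^ 2} = {ω | t ≤ ∑ i, (ξ i ω / s) ^ 2} := by
    ext ω
    simp only [Set.mem_ofPred_eq, div_pow, ← Finset.sum_div]
    rw [le_div_iff₀' (by positivity)]
  rw [hset]
  refine measure_exp_markov ?_ (by fun_prop)
  have e : ∀ ω, ENNReal.ofReal (Real.exp (∑ i, (ξ i ω / s) ^ 2)) =
      ∏ i, ENNReal.ofReal (Real.exp ((ξ i ω / s) ^ 2)) := fun ω => by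
    rw [Real.exp_sum, ENNReal.ofReal_prod_of_nonneg fun _ _ => (Real.exp_pos _).le]
  have hi : iIndepFun (fun i ω => ENNReal.ofReal (Real.exp ((ξ i ω / s) ^ 2))) P :=
    hind.comp (fun _ x => ENNReal.ofReal (Real.exp ((x / s) ^ 2))) fun _ => by fun_prop
  simp only [e]
  rw [lintegral_prod_eq_prod_lintegral_of_indepFun Finset.univ _ hi fun i => by
    have := hm i
    fun_prop]
  calc _ ≤ ∏ _i : ι, ENNReal.ofReal (Real.exp 1) := by
        refine Finset.prod_le_prod' fun i _ => (h2 i).trans ?_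
        rw [show (2 : ℝ≥0∞) = ENNReal.ofReal 2 by simp]
        exact ENNReal.ofReal_le_ofReal (by linarith [Real.add_one_le_exp 1])
    _ = _ := by
        rw [Finset.prod_const, Finset.card_univ, ← ENNReal.ofReal_pow (Real.exp_pos _).le,
          ← Real.exp_nat_mul, mul_one]

end HilbertSchmidt

/-! ### The union bound -/

/-- `Y` is entrywise correlated with a matrix `X` that behaves like one with almost orthonormal
columns. -/
def CorrelatesWithAlmostOrthonormal {n l : ℕ} (Y : Matrix (Fin n) (Fin l) ℝ) : Prop :=
  ∃ X : Matrix (Fin n) (Fin l) ℝ,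
    (∀ u : Fin l → ℝ, ∑ i, (∑ j, X i j * u j) ^ 2 ≤ 25 / 16 * ∑ j, u j ^ 2) ∧
    ∑ i, ∑ j, X i j ^ 2 ≤ l ∧ ∑ i, ∑ j, Y i j ^ 2 ≤ 4 * l ∧
    (l : ℝ) / 2 ≤ ∑ i, ∑ j, X i j * Y i j

theorem AlmostOrthogonal.sum_sq_le {n l : ℕ} {x : Fin l → EuclideanSpace ℝ (Fin n)}
    (h : AlmostOrthogonal (1 / 4) x) (hx : ∀ j, ‖x j‖ = 1) (u : Fin l → ℝ) :
    ∑ i, (∑ j, x j i * u j) ^ 2 ≤ 25 / 16 * ∑ j, u j ^ 2 := by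
  have h1 := LinearMap.norm_apply_sq_le_singularValues
    (Matrix.toEuclideanLin (normalizedColumns x)) (WithLp.toLp 2 u)
  have h0 := LinearMap.singularValues_nonneg (Matrix.toEuclideanLin (normalizedColumns x)) 0
  have h2 : (Matrix.toEuclideanLin (normalizedColumns x)).singularValues 0 ^ 2 ≤ 25 / 16 := by
    nlinarith [h.2.2]
  have h3 := h1.trans (mul_le_mul_of_nonneg_right h2 (sq_nonneg _))
  rw [EuclideanSpace.real_norm_sq_eq, EuclideanSpace.real_norm_sq_eq] at h3
  simpa only [Matrix.toLpLin_apply, Matrix.mulVec, dotProduct, normalizedColumns,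
    Matrix.of_apply, hx, div_one] using h3

/-- The `n × l` matrix of the lattice vectors `h z(j, ·)`. -/
noncomputable def latticeMatrix {n l : ℕ} (h : ℝ) (z : Fin l × Fin n → ℤ) :
    Matrix (Fin n) (Fin l) ℝ :=
  Matrix.of fun i j => h * z (j, i)

theorem exists_latticeMatrix {m n l : ℕ} (hn : 0 < n) {τ R η : ℝ} (hτ : 0 < τ)
    (hτ1 : τ ≤ 1 / 2) (hR : 0 < R) (hη : 2 * (R + 1) * τ ^ 2 ≤ η) (B : Matrix (Fin m) (Fin n) ℝ)
    (hB : ∑ r, ∑ i, B r i ^ 2 ≤ R * n ^ 2) {x : Fin l → EuclideanSpace ℝ (Fin n)}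
    (hx : AlmostOrthogonal (1 / 4) x)
    (hxc : ∀ j, x j ∈ compressibleVectors n (τ ^ 2 * n) (τ ^ 4))
    (hxB : ∀ j, ‖Matrix.toEuclideanLin B (x j)‖ ≤ τ * √(n : ℝ)) :
    ∃ z : Fin l × Fin n → ℤ,
      (∀ j, ∑ i, latticeCost (1 / τ) (τ ^ 3) (z (j, i)) ≤ 12 * τ * n) ∧
      CorrelatesWithAlmostOrthonormal (latticeMatrix (τ / √n) z) ∧
      ∑ r, ∑ j, (B * latticeMatrix (τ / √n) z) r j ^ 2 ≤ η * l * n := by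
  choose z hz1 hz2 hz3 using fun j =>
    exists_lattice_approx_compressible hn hτ (by linarith) hR B hB (hxc j)
  have hx1 (j : Fin l) : ∑ i, x j i ^ 2 = 1 := by
    rw [← EuclideanSpace.real_norm_sq_eq, (hxc j).1, one_pow]
  have hτ2 : τ ^ 2 ≤ 1 / 4 := by nlinarith
  set h := τ / √(n : ℝ)
  refine ⟨fun a => z a.1 a.2, hz1, ⟨Matrix.of fun i j => x j i,
    hx.sum_sq_le fun j => (hxc j).1, ?_, ?_, ?_⟩, ?_⟩
  · rw [Finset.sum_comm]
    simp [hx1]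
  · rw [Finset.sum_comm]
    calc _ ≤ ∑ _j : Fin l, (4 : ℝ) := by
          refine Finset.sum_le_sum fun j _ => ?_
          calc _ ≤ ∑ i, (2 * (h * z j i - x j i) ^ 2 + 2 * x j i ^ 2) := by
                refine Finset.sum_le_sum fun i _ => ?_
                simp only [latticeMatrix, Matrix.of_apply]
                nlinarith [sq_nonneg (h * z j i - x j i - x j i)]
            _ ≤ _ := by
                rw [Finset.sum_add_distrib, ← Finset.mul_sum, ← Finset.mul_sum, hx1]
                linarith [hz2 j]
      _ = _ := by simp [mul_comm]
  · rw [Finset.sum_comm]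
    calc (l : ℝ) / 2 = ∑ _j : Fin l, (1 / 2 : ℝ) := by simp [div_eq_mul_inv]
      _ ≤ _ := by
          refine Finset.sum_le_sum fun j _ => ?_
          calc (1 / 2 : ℝ) ≤ ∑ i, (3 / 4 * x j i ^ 2 - (h * z j i - x j i) ^ 2) := by
                rw [Finset.sum_sub_distrib, ← Finset.mul_sum, hx1]
                linarith [hz2 j]
            _ ≤ _ := by
                refine Finset.sum_le_sum fun i _ => ?_
                simp only [latticeMatrix, Matrix.of_apply]
                nlinarith [sq_nonneg ((h * z j i - x j i) + x j i / 2)]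
  · rw [Finset.sum_comm]
    have hn0 : (0 : ℝ) ≤ n := by positivity
    calc _ ≤ ∑ _j : Fin l, η * n := by
          refine Finset.sum_le_sum fun j _ => ?_
          have hb := hxB j
          have hb2 : ∑ r, (∑ i, B r i * x j i) ^ 2 ≤ τ ^ 2 * n := by
            have h1 := pow_le_pow_left₀ (norm_nonneg _) hb 2
            rw [EuclideanSpace.real_norm_sq_eq, mul_pow, Real.sq_sqrt hn0] at h1
            simpa [Matrix.toLpLin_apply, Matrix.mulVec, dotProduct] using h1
          calc _ ≤ ∑ r, (2 * (∑ i, B r i * (h * z j i - x j i)) ^ 2 +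
                2 * (∑ i, B r i * x j i) ^ 2) := by
                refine Finset.sum_le_sum fun r _ => ?_
                have e : (B * latticeMatrix h fun a => z a.1 a.2) r j =
                    ∑ i, B r i * (h * z j i - x j i) + ∑ i, B r i * x j i := by
                  rw [Matrix.mul_apply, ← Finset.sum_add_distrib]
                  refine Finset.sum_congr rfl fun i _ => ?_
                  simp only [latticeMatrix, Matrix.of_apply]
                  ring
                rw [e]
                nlinarith [sq_nonneg (∑ i, B r i * (h * z j i - x j i) - ∑ i, B r i * x j i)]
            _ ≤ 2 * (R * τ ^ 2 * n) + 2 * (τ ^ 2 * n) := by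
                rw [Finset.sum_add_distrib, ← Finset.mul_sum, ← Finset.mul_sum]
                linarith [hz3 j]
            _ = 2 * (R + 1) * τ ^ 2 * n := by ring
            _ ≤ _ := by gcongr
      _ = _ := by simp; ring

theorem measure_exists_almostOrthogonal_le {Ω : Type*} [MeasurableSpace Ω] {P : Measure Ω}
    {m n l : ℕ} (hn : 0 < n) {τ R η e₂ : ℝ} {e₁ : ℝ≥0∞} (hτ : 0 < τ)
    (hτ1 : τ ≤ 1 / 2) (hR : 0 < R) (hη : 2 * (R + 1) * τ ^ 2 ≤ η)
    (B : Ω → Matrix (Fin m) (Fin n) ℝ)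
    (hHS : P {ω | R * n ^ 2 ≤ ∑ r, ∑ i, B ω r i ^ 2} ≤ e₁)
    (hY : ∀ Y : Matrix (Fin n) (Fin l) ℝ, CorrelatesWithAlmostOrthonormal Y →
      P {ω | ∑ r, ∑ j, (B ω * Y) r j ^ 2 ≤ η * l * n} ≤ ENNReal.ofReal (Real.exp e₂)) :
    P {ω | ∃ x : Fin l → EuclideanSpace ℝ (Fin n), AlmostOrthogonal (1 / 4) x ∧
        (∀ j, x j ∈ compressibleVectors n (τ ^ 2 * n) (τ ^ 4)) ∧
        ∀ j, ‖Matrix.toEuclideanLin (B ω) (x j)‖ ≤ τ * √(n : ℝ)} ≤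
      e₁ + ENNReal.ofReal (Real.exp (60 * τ * l * n + e₂)) := by
  classical
  set f := latticeCost (1 / τ) (τ ^ 3) with hf
  have hf0 (k : ℤ) : 0 ≤ f k := latticeCost_nonneg (by positivity) (by positivity) k
  -- A coordinate `k` costs at least `τ³|k|` out of a budget `12τn`, so a finite box suffices. Its
  -- size does not enter the bound.
  obtain ⟨M, hM⟩ := exists_nat_ge (12 * n / τ ^ 2)
  set Z : Finset (Fin l × Fin n → ℤ) := (Fintype.piFinset fun _ => Finset.Icc (-(M : ℤ)) M).filter
    fun z => ∑ a, f (z a) ≤ 12 * τ * l * n ∧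
      CorrelatesWithAlmostOrthonormal (latticeMatrix (τ / √n) z) with hZ
  have hsub : {ω | ∃ x : Fin l → EuclideanSpace ℝ (Fin n), AlmostOrthogonal (1 / 4) x ∧
        (∀ j, x j ∈ compressibleVectors n (τ ^ 2 * n) (τ ^ 4)) ∧
        ∀ j, ‖Matrix.toEuclideanLin (B ω) (x j)‖ ≤ τ * √(n : ℝ)} ⊆
      {ω | R * n ^ 2 ≤ ∑ r, ∑ i, B ω r i ^ 2} ∪
        ⋃ z ∈ Z, {ω | ∑ r, ∑ j, (B ω * latticeMatrix (τ / √n) z) r j ^ 2 ≤ η * l * n} := by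
    rintro ω ⟨x, hx, hxc, hxB⟩
    by_cases hω : R * n ^ 2 ≤ ∑ r, ∑ i, B ω r i ^ 2
    · exact Or.inl hω
    right
    obtain ⟨z, hz1, hz2, hz3⟩ := exists_latticeMatrix hn hτ hτ1 hR hη (B ω) (not_le.1 hω).le
      hx hxc hxB
    simp only [Set.mem_iUnion]
    refine ⟨z, Finset.mem_filter.2 ⟨Fintype.mem_piFinset.2 fun a => ?_, ?_, hz2⟩, hz3⟩
    · have h1 : f (z a) ≤ 12 * τ * n := (Finset.single_le_sum (f := fun i => f (z (a.1, i)))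
        (fun i _ => hf0 _) (Finset.mem_univ a.2)).trans (hz1 a.1)
      have h2 : τ ^ 3 * |(z a : ℝ)| ≤ f (z a) := by
        rw [hf, latticeCost]
        have : 0 ≤ if z a = 0 then 0 else 1 / τ := by split_ifs <;> positivity
        linarith
      have h3 : |(z a : ℝ)| ≤ M := by
        refine le_trans ?_ hM
        rw [le_div_iff₀ (by positivity)]
        refine le_of_mul_le_mul_left (a := τ) ?_ hτ
        calc _ = τ ^ 3 * |(z a : ℝ)| := by ring
          _ ≤ 12 * τ * n := h2.trans h1
          _ = _ := by ring
      rw [Finset.mem_Icc, ← abs_le]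
      exact_mod_cast h3
    · rw [Fintype.sum_prod_type]
      calc _ ≤ ∑ _j : Fin l, 12 * τ * n := Finset.sum_le_sum fun j _ => hz1 j
        _ = _ := by simp; ring
  -- Counting by weights: every `z` in the net has `1 ≤ exp(12τln) ∏ exp(-f (z a))`. The sum of the
  -- products over the box factors into `ln` one-dimensional sums, each at most `exp(48τ)`; hence
  -- `60 = 12 + 48`.
  have hcount : ∑ z ∈ Z, Real.exp e₂ ≤ Real.exp (60 * τ * l * n + e₂) := by
    calc _ ≤ ∑ z ∈ Z, Real.exp (12 * τ * l * n + e₂) * ∏ a, Real.exp (-f (z a)) := by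
          refine Finset.sum_le_sum fun z hz => ?_
          rw [← Real.exp_sum, ← Real.exp_add, Finset.sum_neg_distrib]
          refine Real.exp_le_exp.2 ?_
          linarith [(Finset.mem_filter.1 hz).2.1]
      _ ≤ ∑ z ∈ Fintype.piFinset fun _ => Finset.Icc (-(M : ℤ)) M,
          Real.exp (12 * τ * l * n + e₂) * ∏ a, Real.exp (-f (z a)) :=
          Finset.sum_le_sum_of_subset_of_nonneg (Finset.filter_subset _ _) fun _ _ _ =>
            mul_nonneg (Real.exp_pos _).le (Finset.prod_nonneg fun _ _ => (Real.exp_pos _).le)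
      _ = Real.exp (12 * τ * l * n + e₂) * ∏ _a : Fin l × Fin n,
          ∑ k ∈ Finset.Icc (-(M : ℤ)) M, Real.exp (-f k) := by
          rw [← Finset.mul_sum, Finset.prod_univ_sum]
      _ ≤ Real.exp (12 * τ * l * n + e₂) * ∏ _a : Fin l × Fin n, Real.exp (48 * τ) := by
          refine mul_le_mul_of_nonneg_left (Finset.prod_le_prod
            (fun _ _ => Finset.sum_nonneg fun _ _ => (Real.exp_pos _).le)
            fun _ _ => sum_exp_neg_latticeCost_le_exp hτ M) (Real.exp_pos _).le
      _ = _ := by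
          rw [Finset.prod_const, ← Real.exp_nat_mul, ← Real.exp_add]
          simp only [Finset.card_univ, Fintype.card_prod, Fintype.card_fin, Nat.cast_mul]
          ring_nf
  calc _ ≤ P {ω | R * n ^ 2 ≤ ∑ r, ∑ i, B ω r i ^ 2} + P (⋃ z ∈ Z,
        {ω | ∑ r, ∑ j, (B ω * latticeMatrix (τ / √n) z) r j ^ 2 ≤ η * l * n}) :=
        (measure_mono hsub).trans (measure_union_le _ _)
    _ ≤ e₁ + ∑ z ∈ Z, ENNReal.ofReal (Real.exp e₂) := by
        refine add_le_add hHS ((measure_biUnion_finset_le _ _).trans ?_)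
        exact Finset.sum_le_sum fun z hz => hY _ (Finset.mem_filter.1 hz).2.2
    _ ≤ _ := by
        gcongr
        rw [← ENNReal.ofReal_sum_of_nonneg fun _ _ => (Real.exp_pos _).le]
        exact ENNReal.ofReal_le_ofReal hcount

/-! ### The proposition -/

theorem two_mul_exp_lt {c x : ℝ} (h : 1 ≤ c * x) :
    Real.exp (-(2 * c * x)) + Real.exp (-(2 * c * x)) < Real.exp (-(c * x)) := by
  have h1 : Real.exp (-(c * x)) = Real.exp (c * x) * Real.exp (-(2 * c * x)) := by
    rw [← Real.exp_add]; ring_nf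
  have h2 : 2 < Real.exp (c * x) :=
    lt_of_lt_of_le (by linarith [Real.exp_one_gt_d9]) (Real.exp_le_exp.2 h)
  rw [h1]
  nlinarith [Real.exp_pos (-(2 * c * x))]

section IIDMatrix

variable {Ω : Type*} [MeasurableSpace Ω] {P : Measure Ω} {K p : ℝ}
  {m n : ℕ} {B : Ω → Matrix (Fin m) (Fin n) ℝ}

theorem IsIIDMatrix.measure_sum_sq_ge_le (hB : IsIIDMatrix P K p B) (hK : 0 < K) (hmn : m ≤ n) :
    P {ω | 2 * (2 * K) ^ 2 * n ^ 2 ≤ ∑ r, ∑ i, B ω r i ^ 2} ≤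
      ENNReal.ofReal (Real.exp (-(n * n))) := by
  have h := _root_.measure_sum_sq_ge_le hB.indep (fun a => (hB.entry a.1 a.2).measurable)
    (by positivity : 0 < 2 * K) (fun a => (hB.entry a.1 a.2).lintegral_exp_sq_le hK)
    (2 * (n : ℝ) ^ 2)
  simp only [Fintype.sum_prod_type, Fintype.card_prod, Fintype.card_fin, Nat.cast_mul] at h
  rw [show (2 * K) ^ 2 * (2 * (n : ℝ) ^ 2) = 2 * (2 * K) ^ 2 * n ^ 2 by ring] at h
  refine h.trans (ENNReal.ofReal_le_ofReal (Real.exp_le_exp.2 ?_))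
  have h2 : (m : ℝ) * n ≤ n * n := by gcongr
  linarith

theorem IsIIDMatrix.measure_sum_sq_mul_le [IsProbabilityMeasure P] (hB : IsIIDMatrix P K p B)
    (hK : 0 < K) (hp : 0 < p) {l : ℕ} {C lam κ : ℝ} (hC : C = 2 * (2 * K) ^ 2)
    (hlam : lam = 1 / (800 + 3200 * C))
    (hκ : κ = min p 1 / 2 / (16 * (1 / lam + 50 * C))) (hmn : (n : ℝ) / 2 ≤ m)
    {Y : Matrix (Fin n) (Fin l) ℝ} (hY : CorrelatesWithAlmostOrthonormal Y) :
    P {ω | ∑ r, ∑ j, (B ω * Y) r j ^ 2 ≤ κ / (4 * lam) * l * n} ≤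
      ENNReal.ofReal (Real.exp (-(κ / 4 * l * n))) := by
  obtain ⟨X, hX, hX2, hY, hXY⟩ := hY
  have hq0 : 0 < min p 1 := lt_min hp one_pos
  have hC0 : 0 < C := by rw [hC]; positivity
  have hlam0 : 0 < lam := by rw [hlam]; positivity
  have hlamC : lam * (800 + 3200 * C) = 1 := by rw [hlam]; field_simp
  have hκ0 : 0 < κ := by rw [hκ]; positivity
  have hmeas (i j) : Measurable fun ω => B ω i j := (hB.entry i j).measurable
  have hξ (i : Fin m) (j : Fin n) (a x : ℝ) (hx0 : 0 ≤ x) (hx1 : x ≤ 1 / 2) :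
      ∫⁻ ω, ENNReal.ofReal (Real.exp (a * B ω i j - x * B ω i j ^ 2)) ∂P ≤
        ENNReal.ofReal (Real.exp (C * a ^ 2 - min p 1 / 2 * x)) := by
    rw [hC]
    exact lintegral_exp_mul_sub_sq_le (by positivity : 0 < 2 * K) (hmeas i j)
      (hB.entry i j).mean_zero ((hB.entry i j).lintegral_exp_sq_le hK) hq0.le (min_le_right _ _)
      (hB.entry i j).measure_abs_le_one_le a hx0 hx1
  have hlC := mul_pos hlam0 hC0
  have h := lintegral_exp_neg_mul_le hB.indep hmeas hC0.le (half_pos hq0).le hξ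
    hlam0 (by linarith) (by linarith) hX hX2 hY hXY
  rw [← hκ] at h
  have hmk := measure_exp_markov (t := -(lam * (κ / (4 * lam) * l * n))) h (by
    simp only [Matrix.mul_apply]
    fun_prop)
  have hset : {ω | ∑ r, ∑ j, (B ω * Y) r j ^ 2 ≤ κ / (4 * lam) * l * n} =
      {ω | -(lam * (κ / (4 * lam) * l * n)) ≤ -(lam * ∑ r, ∑ j, (B ω * Y) r j ^ 2)} := by
    ext ω
    simp only [Set.mem_ofPred_eq, neg_le_neg_iff]
    exact (mul_le_mul_iff_right₀ hlam0).symm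
  rw [hset]
  refine hmk.trans (ENNReal.ofReal_le_ofReal (Real.exp_le_exp.2 ?_))
  -- Since `m ≥ n/2`, the Laplace bound gives `-κln/2`, and the Markov threshold returns only
  -- `κln/4`.
  have h1 : lam * (κ / (4 * lam) * l * n) = κ / 4 * l * n := by field_simp
  have h2 : κ * (n / 2) * l ≤ κ * m * l := by gcongr
  rw [h1]
  linarith

theorem exists_small_pos {κ η R c : ℝ} (hκ : 0 < κ) (hη : 0 < η) (hR : 0 < R) (hc : 0 < c) :
    ∃ τ : ℝ, 0 < τ ∧ τ ≤ 1 / 2 ∧ 480 * τ ≤ κ ∧ 2 * (R + 1) * τ ^ 2 ≤ η ∧ τ ^ 3 ≤ c := by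
  obtain ⟨τ, hτ0, hτ1, hτ2, hτ3, hτ4⟩ : ∃ τ : ℝ, 0 < τ ∧ τ ≤ 1 / 2 ∧ τ ≤ κ / 480 ∧
      τ ≤ η / (2 * (R + 1)) ∧ τ ≤ c :=
    ⟨min (min (1 / 2) (κ / 480)) (min (η / (2 * (R + 1))) c), by positivity,
      (min_le_left _ _).trans (min_le_left _ _), (min_le_left _ _).trans (min_le_right _ _),
      (min_le_right _ _).trans (min_le_left _ _), (min_le_right _ _).trans (min_le_right _ _)⟩
  have h2 : τ ^ 2 ≤ τ := by nlinarith
  rw [le_div_iff₀ (by positivity)] at hτ3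
  refine ⟨τ, hτ0, hτ1, by linarith, ?_, ?_⟩
  · calc 2 * (R + 1) * τ ^ 2 ≤ 2 * (R + 1) * τ := by gcongr
      _ ≤ η := by linarith
  · calc τ ^ 3 ≤ τ := by nlinarith
      _ ≤ c := hτ4

theorem IsIIDMatrix.measure_exists_almostOrthogonal_lt [IsProbabilityMeasure P]
    (hB : IsIIDMatrix P K p B) (hK : 0 < K) (hp : 0 < p) {l : ℕ} {C lam κ c τ : ℝ}
    (hC : C = 2 * (2 * K) ^ 2)
    (hlam : lam = 1 / (800 + 3200 * C))
    (hκ : κ = min p 1 / 2 / (16 * (1 / lam + 50 * C))) (hc0 : 0 < c)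
    (hc1 : 2 * c ≤ κ / 8) (hc2 : 2 * c ≤ 1 / 2) (hτ0 : 0 < τ) (hτ1 : τ ≤ 1 / 2)
    (hτ2 : 480 * τ ≤ κ) (hτ3 : 2 * (C + 1) * τ ^ 2 ≤ κ / (4 * lam)) (hτ4 : τ ^ 3 ≤ c)
    (hmn : (n : ℝ) / 2 ≤ m) (hmn' : m ≤ n) (hl : 1 ≤ l) (hln : (l : ℝ) ≤ τ ^ 3 * n) :
    P {ω | ∃ x : Fin l → EuclideanSpace ℝ (Fin n), AlmostOrthogonal (1 / 4) x ∧
        (∀ j, x j ∈ compressibleVectors n (τ ^ 2 * n) (τ ^ 4)) ∧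
        ∀ j, ‖Matrix.toEuclideanLin (B ω) (x j)‖ ≤ τ * √(n : ℝ)} <
      ENNReal.ofReal (Real.exp (-(c * l * n))) := by
  have hl1 : (1 : ℝ) ≤ l := by exact_mod_cast hl
  have hn : 0 < n := by
    rcases Nat.eq_zero_or_pos n with rfl | h
    · simp at hln; linarith
    · exact h
  have hn0 : (0 : ℝ) < n := by exact_mod_cast hn
  have hτn : τ ^ 3 * n ≤ c * n := by gcongr
  have hlnn : (l : ℝ) ≤ n := by
    have : c * n ≤ 1 * n := by gcongr; linarith
    linarith
  have hC0 : 0 < C := by rw [hC]; positivity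
  have hHS := hB.measure_sum_sq_ge_le hK hmn'
  -- The Hilbert-Schmidt constant `R = 2(2K)²` is the same number as `C`.
  rw [← hC] at hHS
  have hmain := measure_exists_almostOrthogonal_le hn hτ0 hτ1 hC0 hτ3 B hHS
    fun (Y : Matrix (Fin n) (Fin l) ℝ) hY => hB.measure_sum_sq_mul_le hK hp hC hlam hκ hmn hY
  refine hmain.trans_lt ?_
  rw [← ENNReal.ofReal_add (Real.exp_pos _).le (Real.exp_pos _).le,
    ENNReal.ofReal_lt_ofReal_iff (Real.exp_pos _)]
  have h1 : Real.exp (-(n * n : ℝ)) ≤ Real.exp (-(2 * c * (l * n))) := by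
    refine Real.exp_le_exp.2 (neg_le_neg ?_)
    calc 2 * c * (l * n) ≤ 1 * (n * n : ℝ) := by gcongr; linarith
      _ = _ := one_mul _
  have h2 : Real.exp (60 * τ * l * n + -(κ / 4 * l * n)) ≤ Real.exp (-(2 * c * (l * n))) := by
    refine Real.exp_le_exp.2 ?_
    have h1 : (60 * τ + 2 * c) * (l * n) ≤ κ / 4 * (l * n) := by gcongr; linarith
    linarith
  -- From `1 ≤ l ≤ τ³n ≤ cn`. This absorbs the factor 2 from the two error terms and makes the final
  -- inequality strict.
  have hbig : 1 ≤ c * (l * n) := by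
    calc (1 : ℝ) ≤ c * (1 * n) := by linarith
      _ ≤ _ := by gcongr
  have := two_mul_exp_lt hbig
  rw [← mul_assoc c] at this
  exact (add_le_add h1 h2).trans_lt this

end IIDMatrix

theorem proposition4p2 (K p : ℝ) (hK : 0 < K) (hp : 0 < p) :
    ∃ τ : ℝ, 0 < τ ∧ ∃ c : ℝ, 0 < c ∧
      ∀ (Ω : Type*) [MeasurableSpace Ω] (P : Measure Ω) [IsProbabilityMeasure P]
        (k n : ℕ) (_ : (k : ℝ) ≤ (n : ℝ) / 2)
        (B : Ω → Matrix (Fin (n - k)) (Fin n) ℝ) (_ : IsIIDMatrix P K p B)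
        (l : ℕ) (_ : 1 ≤ l) (_ : (l : ℝ) ≤ τ ^ 3 * n),
        P {ω | ∃ x : Fin l → EuclideanSpace ℝ (Fin n),
            AlmostOrthogonal (1 / 4) x ∧
            (∀ j, x j ∈ compressibleVectors n (τ ^ 2 * n) (τ ^ 4)) ∧
            ∀ j, ‖Matrix.toEuclideanLin (B ω) (x j)‖ ≤ τ * √(n : ℝ)}
          < ENNReal.ofReal (Real.exp (-(c * l * n))) := by
  obtain ⟨C, hC⟩ : ∃ C, C = 2 * (2 * K) ^ 2 := ⟨_, rfl⟩
  obtain ⟨lam, hlam⟩ : ∃ lam, lam = 1 / (800 + 3200 * C) := ⟨_, rfl⟩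
  obtain ⟨κ, hκ⟩ : ∃ κ, κ = min p 1 / 2 / (16 * (1 / lam + 50 * C)) := ⟨_, rfl⟩
  have hq0 : 0 < min p 1 := lt_min hp one_pos
  have hC0 : 0 < C := by rw [hC]; positivity
  have hlam0 : 0 < lam := by rw [hlam]; positivity
  have hκ0 : 0 < κ := by rw [hκ]; positivity
  -- Half of the exponent `κ/4` is spent on the net (`60τ ≤ κ/8`), the other half on `2c`. The bound
  -- `2c ≤ 1/2` lets `exp(-n²)` be absorbed. The constant `c` is fixed before `τ`, because `τ³ ≤ c`
  -- is required.
  obtain ⟨c, hc0, hc1, hc2⟩ : ∃ c : ℝ, 0 < c ∧ 2 * c ≤ κ / 8 ∧ 2 * c ≤ 1 / 2 :=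
    ⟨min (κ / 8) (1 / 2) / 2, by positivity, by linarith [min_le_left (κ / 8) (1 / 2)],
      by linarith [min_le_right (κ / 8) (1 / 2)]⟩
  obtain ⟨τ, hτ0, hτ1, hτ2, hτ3, hτ4⟩ :=
    exists_small_pos hκ0 (by positivity : 0 < κ / (4 * lam)) hC0 hc0
  refine ⟨τ, hτ0, c, hc0, fun Ω _ P _ k n hk B hB l hl hln => ?_⟩
  have hkn : k ≤ n := by
    have : (k : ℝ) ≤ n := by linarith [Nat.cast_nonneg (α := ℝ) n]
    exact_mod_cast this
  exact hB.measure_exists_almostOrthogonal_lt hK hp hC hlam hκ hc0 hc1 hc2 hτ0 hτ1 hτ2 hτ3 hτ4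
    (by rw [Nat.cast_sub hkn]; linarith) (Nat.sub_le n k) hl hln
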